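/- Let $K$ be a field, $S=K[x_1,\dots,x_n]$ with its standard grading, and $\mathfrak m=(x_1,\dots,x_n)$. For a finitely generated graded $S$-module $M$, let $\operatorname{hdepth}(M)$ (the Hilbert depth of $M$) be the maximal depth of a finitely generated graded $S$-module $N$ with the same Hilbert series as $M$. For a squarefree monomial ideal $I\subset S$ let $\alpha_j(S/I)$ be the number of squarefree monomials of degree $j$ of $S$ that do not lie in $I$, and for $0\le k\le q$ put $$\beta_k^q(S/I)=\sum_{j=0}^k(-1)^{k-j}\binom{q-j}{k-j}\alpha_j(S/I).$$ (1) If $I\subset S$ is a squarefree monomial ideal with $I\subset\mathfrak m^2$ and $q=\operatorname{hdepth}(S/I)\in\{5,6,7\}$, then $$\beta_3^q(S/I)\le\binom{n-q+2}{3}.$$ (2) For $q\ge 8$ this fails in general: for every field $K$ and every integer $q\ge 8$ there are $n\ge q$ and a squarefree monomial ideal $I\subset K[x_1,\dots,x_n]$ with $I\subset\mathfrak m^2$, $\operatorname{hdepth}(S/I)=q$ and $$\beta_3^q(S/I)>\binom{n-q+2}{3}.$$ -/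

import Mathlib

universe u

namespace HilbertDepth

open MvPolynomial

/-- A finitely generated `ℤ`-graded module over the standard graded polynomial ring
`S = K[x_1, …, x_n]`: a finitely generated `S`-module that is the direct sum of `K`-subspaces
`piece j`, `j : ℤ`, such that `S_i • piece j ⊆ piece (i + j)`. -/
structure FGGradedModule (K : Type u) [Field K] (n : ℕ) where
  carrier : Type u
  [addCommGroup : AddCommGroup carrier]
  [moduleBase : Module K carrier]
  [module : Module (MvPolynomial (Fin n) K) carrier]
  [isScalarTower : IsScalarTower K (MvPolynomial (Fin n) K) carrier]
  finite : Module.Finite (MvPolynomial (Fin n) K) carrier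
  piece : ℤ → Submodule K carrier
  isInternal : DirectSum.IsInternal piece
  smul_mem : ∀ (i : ℕ) (j : ℤ) (f : MvPolynomial (Fin n) K) (m : carrier),
    f ∈ homogeneousSubmodule (Fin n) K i → m ∈ piece j → f • m ∈ piece (i + j)

namespace FGGradedModule

attribute [instance] addCommGroup moduleBase module isScalarTower

variable {K : Type u} [Field K] {n : ℕ}

/-- The Hilbert function `j ↦ dim_K M_j`, i.e. the coefficients of the Hilbert series of `M`. -/
noncomputable def hilbertFunction (M : FGGradedModule K n) (j : ℤ) : ℕ :=
  Module.finrank K (M.piece j)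

/-- The depth of `M`: the supremum of the lengths of the `M`-regular sequences consisting of
elements of the maximal ideal `𝔪 = (x_1, …, x_n)`. -/
noncomputable def depth (M : FGGradedModule K n) : ℕ∞ :=
  ⨆ (rs : List (MvPolynomial (Fin n) K)) (_ : ∀ r ∈ rs, r ∈ idealOfVars (Fin n) K)
    (_ : RingTheory.Sequence.IsRegular M.carrier rs), (rs.length : ℕ∞)

/-- The Hilbert depth of `M`: the maximal depth of a finitely generated graded `S`-module with
the same Hilbert series as `M`. -/
noncomputable def hdepth (M : FGGradedModule K n) : ℕ∞ :=
  ⨆ (N : FGGradedModule K n) (_ : N.hilbertFunction = M.hilbertFunction), N.depth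

end FGGradedModule

section Quotient

attribute [local instance] MvPolynomial.gradedAlgebra

variable {K : Type u} [Field K] {n : ℕ}

/-- The degree `j` part of `S/I`: the image of the space of forms of degree `j`
(zero for `j < 0`). -/
noncomputable def quotientPiece (I : Ideal (MvPolynomial (Fin n) K)) :
    ℤ → Submodule K (MvPolynomial (Fin n) K ⧸ I)
  | Int.ofNat d => (homogeneousSubmodule (Fin n) K d).map (Ideal.Quotient.mkₐ K I).toLinearMap
  | Int.negSucc _ => ⊥

theorem homogeneousComponent_mem {I : Ideal (MvPolynomial (Fin n) K)}
    (hI : I.IsHomogeneous (homogeneousSubmodule (Fin n) K)) (d : ℕ)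
    {p : MvPolynomial (Fin n) K} (hp : p ∈ I) : homogeneousComponent d p ∈ I := by
  have h := hI d hp
  rw [← MvPolynomial.decomposition.decompose'_apply]
  exact h

theorem mk_mem_quotientPiece (I : Ideal (MvPolynomial (Fin n) K)) {d : ℕ}
    {p : MvPolynomial (Fin n) K} (hp : p ∈ homogeneousSubmodule (Fin n) K d) :
    Ideal.Quotient.mk I p ∈ quotientPiece I d :=
  ⟨p, hp, rfl⟩

theorem quotientPiece_isInternal {I : Ideal (MvPolynomial (Fin n) K)}
    (hI : I.IsHomogeneous (homogeneousSubmodule (Fin n) K)) :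
    DirectSum.IsInternal (quotientPiece I) := by
  classical
  rw [DirectSum.isInternal_submodule_iff_iSupIndep_and_iSup_eq_top]
  constructor
  · -- the projections to the homogeneous parts descend to the quotient
    let π : ℕ → (MvPolynomial (Fin n) K ⧸ I) →ₗ[K] (MvPolynomial (Fin n) K ⧸ I) := fun d =>
      Submodule.mapQ (I.restrictScalars K) (I.restrictScalars K) (homogeneousComponent d)
        (fun _ hp => homogeneousComponent_mem hI d hp)
    have hπ : ∀ d p, π d (Ideal.Quotient.mk I p) = Ideal.Quotient.mk I (homogeneousComponent d p) :=
      fun d p => rfl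
    rw [iSupIndep_def]
    intro j
    rw [Submodule.disjoint_def]
    intro x hx hx'
    rcases j with d | d
    · have h1 : π d x = x := by
        obtain ⟨p, hp, rfl⟩ := hx
        change π d (Ideal.Quotient.mk I p) = Ideal.Quotient.mk I p
        rw [hπ, homogeneousComponent_of_mem hp, if_pos rfl]
      have h2 : (⨆ i, ⨆ (_ : i ≠ Int.ofNat d), quotientPiece I i) ≤ LinearMap.ker (π d) := by
        refine iSup_le fun i => iSup_le fun hi => ?_
        rcases i with e | e
        · rintro _ ⟨p, hp, rfl⟩
          change π d (Ideal.Quotient.mk I p) = 0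
          rw [hπ, homogeneousComponent_of_mem hp, if_neg, map_zero]
          rintro rfl
          exact hi rfl
        · exact bot_le
      rw [← h1]
      exact h2 hx'
    · exact hx
  · rw [eq_top_iff]
    rintro x -
    obtain ⟨p, rfl⟩ := Ideal.Quotient.mk_surjective x
    rw [← sum_homogeneousComponent p, map_sum]
    refine Submodule.sum_mem _ fun d _ => ?_
    exact Submodule.mem_iSup_of_mem (d : ℤ)
      (mk_mem_quotientPiece I (homogeneousComponent_isHomogeneous d p))

/-- The graded `S`-module `S/I` of a homogeneous ideal `I`. -/
noncomputable def quotientModule (I : Ideal (MvPolynomial (Fin n) K))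
    (hI : I.IsHomogeneous (homogeneousSubmodule (Fin n) K)) : FGGradedModule K n where
  carrier := MvPolynomial (Fin n) K ⧸ I
  finite := inferInstance
  piece := quotientPiece I
  isInternal := quotientPiece_isInternal hI
  smul_mem := by
    intro i j f m hf hm
    rcases j with d | d
    · obtain ⟨p, hp, rfl⟩ := hm
      refine ⟨f * p, ?_, rfl⟩
      exact IsHomogeneous.mul hf hp
    · have hm0 : m = 0 := hm
      rw [hm0, smul_zero]
      exact Submodule.zero_mem _

/-- The squarefree monomial `x_A = ∏_{i ∈ A} x_i`. -/
noncomputable def sqfreeMonomial (K : Type u) [Field K] {n : ℕ} (A : Finset (Fin n)) :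
    MvPolynomial (Fin n) K :=
  ∏ i ∈ A, X i

/-- A squarefree monomial ideal is an ideal generated by squarefree monomials. -/
def IsSquarefreeMonomialIdeal (I : Ideal (MvPolynomial (Fin n) K)) : Prop :=
  ∃ F : Set (Finset (Fin n)), I = Ideal.span (sqfreeMonomial K '' F)

theorem IsSquarefreeMonomialIdeal.isHomogeneous {I : Ideal (MvPolynomial (Fin n) K)}
    (hI : IsSquarefreeMonomialIdeal I) : I.IsHomogeneous (homogeneousSubmodule (Fin n) K) := by
  obtain ⟨F, rfl⟩ := hI
  refine Ideal.homogeneous_span _ _ ?_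
  rintro _ ⟨A, -, rfl⟩
  refine ⟨A.sum fun _ => 1, ?_⟩
  exact IsHomogeneous.prod A _ _ fun i _ => isHomogeneous_X K i

/-- The graded module `S/I` of a squarefree monomial ideal `I`. -/
noncomputable def sqfreeQuotient (I : Ideal (MvPolynomial (Fin n) K))
    (hI : IsSquarefreeMonomialIdeal I) : FGGradedModule K n :=
  quotientModule I hI.isHomogeneous

/-- `α_j(J/I)`: the number of squarefree monomials of degree `j` in `J` but not in `I`.
The case `J = S = ⊤` is `α_j(S/I)`. -/
noncomputable def alpha (J I : Ideal (MvPolynomial (Fin n) K)) (j : ℕ) : ℕ :=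
  {A : Finset (Fin n) | A.card = j ∧ sqfreeMonomial K A ∈ J ∧ sqfreeMonomial K A ∉ I}.ncard

/-- `β_k^q(J/I) = ∑_{j=0}^k (-1)^{k-j} * binom(q-j, k-j) * α_j(J/I)`, for `k ≤ q`. -/
noncomputable def beta (J I : Ideal (MvPolynomial (Fin n) K)) (q k : ℕ) : ℤ :=
  ∑ j ∈ Finset.range (k + 1), (-1) ^ (k - j) * ((q - j).choose (k - j) : ℤ) * (alpha J I j : ℤ)

end Quotient

end HilbertDepth

/-! Write `H` for the Hilbert series of `S/I`. For `k ≤ r` the number `β_k^r` is the coefficient of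
`X^k` in `(1 - X)^r H`. The algebraic input is that `r ≤ hdepth(S/I)` holds exactly when all `β_k^r`
with `k ≤ r` are nonnegative (given `r ≤ n` and `I ≠ S` for the construction).

Necessity (`beta_nonneg_of_le_hdepth`): after extension to an infinite field, a regular sequence in
`𝔪` can be replaced by one of generic linear forms of the same length, and each linear form
multiplies the Hilbert series by `1 - X`. Sufficiency (`le_hdepth_of_beta_nonneg`): nonnegative
coefficients are multiplicities in a direct sum of shifted polynomial rings with Hilbert series `H`.

For (1), `β_3^q` is affine in the numbers `α_2`, `α_3` of edges and triangles of the Stanley–Reisner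
complex, and a full simplex attains `binom(n-q+2, 3)`. For `n ≥ 3q - 4` the local LYM inequality
bounds `β_3^q` by a nondecreasing function of `α_2` that is largest at the simplex. For smaller `n`,
nonnegativity of `β_1^q` and `β_2^q` together with Kruskal–Katona leaves a finite check. Its only
exception, `q = 7`, `n = 11`, `α_2 = 45`, is excluded by `β_4^7 ≥ 0`.

For (2), take a simplex on `q + z + 1` vertices and an isolated point, with `z` minimal such that
all `β_k^q` are nonnegative. Minimality makes some `β_k^{q+1}` negative, so the Hilbert depth is
`q`, and `z ≤ q - 5` makes `β_3^q` too large. -/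

namespace HilbertDepth

open RingTheory.Sequence Pointwise

/-! ### Exchange of regular elements and generic linear forms -/

section Exchange

variable {R : Type*} [CommRing R] {M : Type*} [AddCommGroup M] [Module R M]

/-- The ideal `I` contains a weakly `M`-regular sequence of length `r`. -/
def HasRegSeq (I : Ideal R) (r : ℕ) (M : Type*) [AddCommGroup M] [Module R M] : Prop :=
  ∃ rs : List R, rs.length = r ∧ (∀ a ∈ rs, a ∈ I) ∧ IsWeaklyRegular M rs

/-- The only element of `M` that is annihilated by `I` is zero. -/
def TrivialSocle (I : Ideal R) (M : Type*) [AddCommGroup M] [Module R M] : Prop :=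
  ∀ m : M, (∀ a ∈ I, a • m = 0) → m = 0

theorem trivialSocle_of_isSMulRegular {I : Ideal R} {a : R} (ha : a ∈ I)
    (h : IsSMulRegular M a) : TrivialSocle I M :=
  fun _ hm => h.right_eq_zero_of_smul (hm a ha)

theorem TrivialSocle.prod {I : Ideal R} {M' : Type*} [AddCommGroup M'] [Module R M']
    (h : TrivialSocle I M) (h' : TrivialSocle I M') : TrivialSocle I (M × M') := fun _ hm =>
  Prod.ext (h _ fun a ha => congrArg Prod.fst (hm a ha))
    (h' _ fun a ha => congrArg Prod.snd (hm a ha))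

theorem isSMulRegular_of_prod {M' : Type*} [AddCommGroup M'] [Module R M'] {a : R}
    (h : IsSMulRegular (M × M') a) : IsSMulRegular M a ∧ IsSMulRegular M' a := by
  refine ⟨fun x y hxy => ?_, fun x y hxy => ?_⟩
  · exact congrArg Prod.fst (@h (x, 0) (y, 0) (Prod.ext hxy rfl))
  · exact congrArg Prod.snd (@h (0, x) (0, y) (Prod.ext rfl hxy))

/-- Prime avoidance with coefficients in `L`. The zero divisors on `M` are the union of finitely
many associated primes; none of them contains all `x i`, so each pulls back to a proper subspace of
`ι → L`, and finitely many proper subspaces do not cover a space over an infinite field. -/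
theorem exists_linearCombination_isSMulRegular {L : Type*} [Field L] [Infinite L] [Algebra L R]
    [IsNoetherianRing R] [Module.Finite R M] {ι : Type*} [Fintype ι] (x : ι → R)
    (h : TrivialSocle (Ideal.span (Set.range x)) M) :
    ∃ c : ι → L, IsSMulRegular M (∑ i, c i • x i) := by
  classical
  let φ : (ι → L) →ₗ[L] R := Fintype.linearCombination L x
  have hfin := associatedPrimes.finite R M
  let s : Finset (Subspace L (ι → L)) :=
    hfin.toFinset.image fun P => (P.restrictScalars L).comap φ
  have hs : ⊤ ∉ s := by
    intro hs
    obtain ⟨P, hP, hPs⟩ := Finset.mem_image.mp hs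
    have hP' : IsAssociatedPrime P M := hfin.mem_toFinset.mp hP
    obtain ⟨hprime, m, hm⟩ := isAssociatedPrime_iff.mp hP'
    refine hprime.ne_top ?_
    have hle : Ideal.span (Set.range x) ≤ P := by
      rw [Ideal.span_le]
      rintro _ ⟨i, rfl⟩
      have : Pi.single i 1 ∈ (P.restrictScalars L).comap φ := by rw [hPs]; trivial
      simpa [φ] using this
    have : m = 0 := h m fun a ha => by
      have := hle ha
      rw [hm] at this
      simpa using this
    rw [hm, this]
    simp
  have hne := Subspace.biUnion_ne_univ_of_top_notMem hs
  obtain ⟨c, hc⟩ := (Set.ne_univ_iff_exists_notMem _).mp hne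
  refine ⟨c, ?_⟩
  by_contra hreg
  have : (∑ i, c i • x i) ∈ ⋃ p ∈ associatedPrimes R M, (p : Set R) := by
    rw [biUnion_associatedPrimes_eq_compl_regular]
    exact hreg
  simp only [Set.mem_iUnion] at this
  obtain ⟨P, hP, hmem⟩ := this
  refine hc (Set.mem_biUnion (Finset.mem_coe.mpr
    (Finset.mem_image_of_mem _ (hfin.mem_toFinset.mpr hP))) ?_)
  simpa [φ, Fintype.linearCombination_apply] using hmem

theorem mem_smul_top_iff {a : R} {m : M} : m ∈ a • (⊤ : Submodule R M) ↔ ∃ m', a • m' = m := by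
  rw [Submodule.mem_smul_pointwise_iff_exists]
  simp

theorem mk_eq_zero_iff {a : R} {m : M} :
    (Submodule.Quotient.mk m : QuotSMulTop a M) = 0 ↔ ∃ m', a • m' = m := by
  rw [Submodule.Quotient.mk_eq_zero, mem_smul_top_iff]

/-- Behind this is `Hom(R/I, M/fM) ≅ Ext¹(R/I, M)`, which does not depend on the regular element `f`
of `I`. Concretely, a socle element `m` modulo `g` gives `w f` with `g • w f = f • m`, and `w f` is
a socle element modulo `f`. -/
theorem TrivialSocle.exchange {I : Ideal R} {f g : R} (hf : IsSMulRegular M f) (hfI : f ∈ I)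
    (hg : IsSMulRegular M g) (h : TrivialSocle I (QuotSMulTop f M)) :
    TrivialSocle I (QuotSMulTop g M) := by
  intro m hm
  obtain ⟨m, rfl⟩ := Submodule.Quotient.mk_surjective _ m
  have key : ∀ a ∈ I, ∃ m', g • m' = a • m := fun a ha => by
    have := hm a ha
    rwa [← Submodule.Quotient.mk_smul, mk_eq_zero_iff] at this
  choose! w hw using key
  have h0 : (Submodule.Quotient.mk (w f) : QuotSMulTop f M) = 0 := by
    refine h _ fun a ha => ?_
    rw [← Submodule.Quotient.mk_smul, mk_eq_zero_iff]
    refine ⟨w a, hg ?_⟩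
    change g • f • w a = g • a • w f
    rw [smul_comm g f, hw a ha, smul_comm g a, hw f hfI, smul_comm]
  obtain ⟨m', hm'⟩ := mk_eq_zero_iff.mp h0
  refine mk_eq_zero_iff.mpr ⟨m', hf ?_⟩
  change f • g • m' = f • m
  rw [smul_comm, hm', hw f hfI]

/-- In a swap of a regular pair, only the regularity of `h` on `M` itself can fail; hence the swaps
below use an element chosen to be regular on `M` as well. -/
theorem isSMulRegular_quotSMulTop_swap {f h : R} (hf : IsSMulRegular M f)
    (hhf : IsSMulRegular (QuotSMulTop f M) h) :
    IsSMulRegular (QuotSMulTop h M) f := by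
  refine IsSMulRegular.of_right_eq_zero_of_smul fun m hm => ?_
  obtain ⟨m, rfl⟩ := Submodule.Quotient.mk_surjective _ m
  rw [← Submodule.Quotient.mk_smul, mk_eq_zero_iff] at hm
  obtain ⟨m', hm'⟩ := hm
  have h0 : (Submodule.Quotient.mk m' : QuotSMulTop f M) = 0 := by
    refine hhf.right_eq_zero_of_smul ?_
    rw [← Submodule.Quotient.mk_smul, mk_eq_zero_iff]
    exact ⟨m, hm'.symm⟩
  obtain ⟨m'', hm''⟩ := mk_eq_zero_iff.mp h0
  refine mk_eq_zero_iff.mpr ⟨m'', hf ?_⟩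
  change f • h • m'' = f • m
  rw [smul_comm, hm'', hm']

theorem quotSMulTop_comm (f h : R) :
    Nonempty (QuotSMulTop h (QuotSMulTop f M) ≃ₗ[R] QuotSMulTop f (QuotSMulTop h M)) := by
  have aux : ∀ a b : R, ∃ φ : QuotSMulTop b (QuotSMulTop a M) →ₗ[R] QuotSMulTop a (QuotSMulTop b M),
      ∀ m : M, φ (Submodule.Quotient.mk (Submodule.Quotient.mk m)) =
        Submodule.Quotient.mk (Submodule.Quotient.mk m) := by
    intro a b
    refine ⟨Submodule.liftQ _ (Submodule.liftQ _ (Submodule.mkQ _ ∘ₗ Submodule.mkQ _) ?_) ?_, ?_⟩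
    · intro m hm
      obtain ⟨m, rfl⟩ := mem_smul_top_iff.mp hm
      exact mk_eq_zero_iff.mpr ⟨Submodule.Quotient.mk m, rfl⟩
    · intro m hm
      obtain ⟨m, rfl⟩ := mem_smul_top_iff.mp hm
      obtain ⟨m, rfl⟩ := Submodule.Quotient.mk_surjective _ m
      change (Submodule.Quotient.mk (Submodule.Quotient.mk (b • m)) :
        QuotSMulTop a (QuotSMulTop b M)) = 0
      have : (Submodule.Quotient.mk (b • m) : QuotSMulTop b M) = 0 := mk_eq_zero_iff.mpr ⟨m, rfl⟩
      rw [this, Submodule.Quotient.mk_zero]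
    · intro m
      rfl
  obtain ⟨φ, hφ⟩ := aux f h
  obtain ⟨ψ, hψ⟩ := aux h f
  refine ⟨LinearEquiv.ofLinearMap φ ψ ?_ ?_⟩
  · ext m
    exact (congrArg φ (hψ m)).trans (hφ m)
  · ext m
    exact (congrArg ψ (hφ m)).trans (hψ m)

theorem HasRegSeq.congr {I : Ideal R} {r : ℕ} {M' : Type*} [AddCommGroup M'] [Module R M']
    (e : M ≃ₗ[R] M') (h : HasRegSeq I r M) : HasRegSeq I r M' := by
  obtain ⟨rs, h1, h2, h3⟩ := h
  exact ⟨rs, h1, h2, (e.isWeaklyRegular_congr rs).mp h3⟩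

theorem HasRegSeq.cons {I : Ideal R} {r : ℕ} {a : R} (ha : a ∈ I) (hreg : IsSMulRegular M a)
    (h : HasRegSeq I r (QuotSMulTop a M)) : HasRegSeq I (r + 1) M := by
  obtain ⟨rs, h1, h2, h3⟩ := h
  exact ⟨a :: rs, by simp [h1], by simpa [ha] using h2, h3.cons hreg⟩

theorem HasRegSeq.exists_cons {I : Ideal R} {r : ℕ} (h : HasRegSeq I (r + 1) M) :
    ∃ a ∈ I, IsSMulRegular M a ∧ HasRegSeq I r (QuotSMulTop a M) := by
  obtain ⟨rs, h1, h2, h3⟩ := h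
  obtain ⟨a, rs, rfl⟩ := List.exists_cons_of_length_eq_add_one h1
  rw [isWeaklyRegular_cons_iff] at h3
  simp only [List.mem_cons, forall_eq_or_imp] at h2
  exact ⟨a, h2.1, h3.1, rs, by simpa using h1, h2.2, h3.2⟩

theorem HasRegSeq.trivialSocle {I : Ideal R} {r : ℕ} (h : HasRegSeq I (r + 1) M) :
    TrivialSocle I M := by
  obtain ⟨a, ha, hreg, -⟩ := h.exists_cons
  exact trivialSocle_of_isSMulRegular ha hreg

/-- Dividing out a regular element shortens the maximal regular sequences by at most one. -/
theorem HasRegSeq.quotSMulTop (L : Type*) [Field L] [Infinite L] [Algebra L R]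
    [IsNoetherianRing R] {ι : Type*} [Fintype ι] (x : ι → R) (r : ℕ) {M : Type*} [AddCommGroup M]
    [Module R M] [Module.Finite R M] (h : HasRegSeq (Ideal.span (Set.range x)) (r + 1) M) {g : R}
    (hgI : g ∈ Ideal.span (Set.range x)) (hg : IsSMulRegular M g) :
    HasRegSeq (Ideal.span (Set.range x)) r (QuotSMulTop g M) := by
  induction r generalizing M g with
  | zero => exact ⟨[], rfl, by simp, by simp⟩
  | succ r ih =>
    obtain ⟨f, hfI, hf, hseq⟩ := h.exists_cons
    have hsf := hseq.trivialSocle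
    have hsg := hsf.exchange hf hfI hg
    -- One generic linear combination `a` is regular on `M`, `M/fM` and `M/gM` at once, because it
    -- is regular on their product. It mediates between `f` and `g`.
    obtain ⟨c, hc⟩ := exists_linearCombination_isSMulRegular (L := L) x
      (h.trivialSocle.prod (hsf.prod hsg))
    set a := ∑ i, c i • x i
    have haI : a ∈ Ideal.span (Set.range x) := Ideal.sum_mem _ fun i _ =>
      Submodule.smul_of_tower_mem _ _ (Ideal.subset_span ⟨i, rfl⟩)
    obtain ⟨ha, haf, hag⟩ := (isSMulRegular_of_prod hc).imp_right isSMulRegular_of_prod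
    -- By induction on `M/fM`, the module `M/(f,a)M` keeps a sequence of length `r`; prepending `f`
    -- gives one of length `r + 1` on `M/aM`. Induction on `M/aM` then allows division by `g`, and
    -- `a` is prepended on `M/gM`.
    have h1 : HasRegSeq (Ideal.span (Set.range x)) (r + 1) (QuotSMulTop a M) :=
      .cons hfI (isSMulRegular_quotSMulTop_swap hf haf)
        ((ih hseq haI haf).congr (quotSMulTop_comm f a).some)
    exact .cons haI hag ((ih h1 hgI (isSMulRegular_quotSMulTop_swap hg hag)).congr
      (quotSMulTop_comm a g).some)

end Exchange

/-! ### Nonnegativity of differences of the Hilbert function -/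

section Positivity

/-- The backward difference of a function on `ℤ`. -/
def backwardDiff (H : ℤ → ℤ) (j : ℤ) : ℤ := H j - H (j - 1)

variable {L : Type*} [Field L] {R : Type*} [CommRing R] [Algebra L R]

theorem exists_quotSMulTop_map {M : Type*} [AddCommGroup M] [Module L M] [Module R M]
    [IsScalarTower L R M] (a : R) (π π' : M →ₗ[L] M) (hcomm : ∀ m, π (a • m) = a • π' m) :
    ∃ ρ : QuotSMulTop a M →ₗ[L] QuotSMulTop a M,
      ∀ m, ρ (Submodule.Quotient.mk m) = Submodule.Quotient.mk (π m) := by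
  have hle : (a • (⊤ : Submodule R M)).restrictScalars L ≤
      ((a • (⊤ : Submodule R M)).restrictScalars L).comap π := by
    intro m hm
    obtain ⟨m, rfl⟩ := mem_smul_top_iff.mp hm
    exact mem_smul_top_iff.mpr ⟨_, (hcomm m).symm⟩
  let e := Submodule.Quotient.restrictScalarsEquiv L (a • (⊤ : Submodule R M))
  refine ⟨e.toLinearMap ∘ₗ Submodule.mapQ _ _ π hle ∘ₗ e.symm.toLinearMap, fun m => ?_⟩
  rw [LinearMap.comp_apply, LinearMap.comp_apply, LinearEquiv.coe_coe, LinearEquiv.coe_coe,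
    Submodule.Quotient.restrictScalarsEquiv_symm_mk, Submodule.mapQ_apply,
    Submodule.Quotient.restrictScalarsEquiv_mk]

/-- With the ranges of the projections as graded pieces, this is the dimension count in `0 → M_{j-1}
→ M_j → (M/ℓM)_j → 0`, whose first map is multiplication by `ℓ`. -/
theorem finrank_range_quotient {M : Type*} [AddCommGroup M] [Module L M] [Module R M]
    [IsScalarTower L R M] (ℓ : R) (hℓ : IsSMulRegular M ℓ) (π π' : M →ₗ[L] M)
    (hπ : ∀ m, π (π m) = π m) (hcomm : ∀ m, π (ℓ • m) = ℓ • π' m)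
    [FiniteDimensional L (LinearMap.range π)] [FiniteDimensional L (LinearMap.range π')]
    (ρ : QuotSMulTop ℓ M →ₗ[L] QuotSMulTop ℓ M)
    (hρ : ∀ m, ρ (Submodule.Quotient.mk m) = Submodule.Quotient.mk (π m)) :
    FiniteDimensional L (LinearMap.range ρ) ∧
    (Module.finrank L (LinearMap.range ρ) : ℤ) =
      Module.finrank L (LinearMap.range π) - Module.finrank L (LinearMap.range π') := by
  have hsurj : ∀ y : LinearMap.range π, (Submodule.Quotient.mk (y : M) : QuotSMulTop ℓ M) ∈
      LinearMap.range ρ := by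
    rintro ⟨_, m, rfl⟩
    exact ⟨_, hρ m⟩
  let q : LinearMap.range π →ₗ[L] LinearMap.range ρ :=
    { toFun := fun y => ⟨Submodule.Quotient.mk (y : M), hsurj y⟩
      map_add' := fun _ _ => rfl
      map_smul' := fun c y => rfl }
  have hq : Function.Surjective q := by
    rintro ⟨_, m, rfl⟩
    obtain ⟨m, rfl⟩ := Submodule.Quotient.mk_surjective _ m
    exact ⟨⟨π m, m, rfl⟩, Subtype.ext (hρ m).symm⟩
  let s : LinearMap.range π' →ₗ[L] LinearMap.range π :=
    { toFun := fun y => ⟨ℓ • (y : M), by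
        obtain ⟨_, m, rfl⟩ := y
        exact ⟨ℓ • m, hcomm m⟩⟩
      map_add' := fun _ _ => Subtype.ext (smul_add _ _ _)
      map_smul' := fun c y => Subtype.ext (smul_comm ℓ c (y : M)) }
  have hs : Function.Injective s := fun y z hyz => Subtype.ext (hℓ (congrArg Subtype.val hyz))
  have hker : LinearMap.ker q = LinearMap.range s := by
    ext y
    rw [LinearMap.mem_ker, LinearMap.mem_range]
    constructor
    · intro hy
      obtain ⟨m, hm⟩ := mk_eq_zero_iff.mp (congrArg Subtype.val hy)
      refine ⟨⟨π' m, m, rfl⟩, Subtype.ext ?_⟩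
      obtain ⟨_, z, rfl⟩ := y
      change ℓ • π' m = π z
      rw [← hcomm, hm]
      exact hπ z
    · rintro ⟨z, rfl⟩
      exact Subtype.ext (mk_eq_zero_iff.mpr ⟨z, rfl⟩)
  have hfd := Module.Finite.of_surjective q hq
  refine ⟨hfd, ?_⟩
  have h1 := LinearMap.finrank_range_add_finrank_ker q
  rw [hker, LinearMap.finrank_range_of_inj hs, LinearMap.range_eq_top.mpr hq, finrank_top] at h1
  omega

/-- If a module that is graded by projections `π j` has a weakly regular sequence of length `r`
in the ideal generated by the degree one elements `x i`, the `r`-th backward difference of its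
Hilbert function is nonnegative. -/
theorem HasRegSeq.iterate_backwardDiff_nonneg [Infinite L] [IsNoetherianRing R]
    {ι : Type*} [Fintype ι] (x : ι → R) (r : ℕ) {M : Type*} [AddCommGroup M] [Module L M]
    [Module R M] [IsScalarTower L R M] [Module.Finite R M] (π : ℤ → M →ₗ[L] M)
    (hπ : ∀ j m, π j (π j m) = π j m) (hcomm : ∀ i j m, π j (x i • m) = x i • π (j - 1) m)
    (hfin : ∀ j, FiniteDimensional L (LinearMap.range (π j)))
    (h : HasRegSeq (Ideal.span (Set.range x)) r M) (k : ℤ) :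
    0 ≤ backwardDiff^[r] (fun j => (Module.finrank L (LinearMap.range (π j)) : ℤ)) k := by
  induction r generalizing M with
  | zero => simp
  | succ r ih =>
    -- The given sequence need not be homogeneous. Its first member is traded for a linear form `a`,
    -- for which `M/aM` is graded again; `HasRegSeq.quotSMulTop` guarantees that length `r`
    -- survives.
    obtain ⟨c, hc⟩ := exists_linearCombination_isSMulRegular (L := L) x h.trivialSocle
    set a := ∑ i, c i • x i with ha
    have haI : a ∈ Ideal.span (Set.range x) := Ideal.sum_mem _ fun i _ =>
      Submodule.smul_of_tower_mem _ _ (Ideal.subset_span ⟨i, rfl⟩)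
    have hacomm : ∀ j m, π j (a • m) = a • π (j - 1) m := fun j m => by
      simp [ha, Finset.sum_smul, hcomm]
    choose ρ hρ using fun j => exists_quotSMulTop_map a (π j) (π (j - 1)) (hacomm j)
    have hdim := fun j => finrank_range_quotient a hc (π j) (π (j - 1)) (hπ _)
      (hacomm j) (ρ j) (hρ j)
    have hρ2 : ∀ j m, ρ j (ρ j m) = ρ j m := fun j m => by
      obtain ⟨m, rfl⟩ := Submodule.Quotient.mk_surjective _ m
      rw [hρ, hρ, hπ]
    have hρc : ∀ i j m, ρ j (x i • m) = x i • ρ (j - 1) m := fun i j m => by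
      obtain ⟨m, rfl⟩ := Submodule.Quotient.mk_surjective _ m
      rw [hρ, ← Submodule.Quotient.mk_smul, hρ, hcomm, Submodule.Quotient.mk_smul]
    have := ih ρ hρ2 hρc
      (fun j => (hdim j).1) (h.quotSMulTop L x r haI hc)
    simp only [(hdim _).2] at this
    exact this

end Positivity

end HilbertDepth

namespace HilbertDepth

open RingTheory.Sequence Pointwise MvPolynomial TensorProduct

/-! ### Graded pieces and extension of the base field -/

namespace FGGradedModule

variable {K : Type u} [Field K] {n : ℕ} (N : FGGradedModule K n)

/-- The projection of a graded module onto its part of degree `j`. -/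
noncomputable def toPiece (j : ℤ) : N.carrier →ₗ[K] N.piece j :=
  DirectSum.component K ℤ (fun i => N.piece i) j ∘ₗ
    (LinearEquiv.ofBijective (DirectSum.coeLinearMap N.piece) N.isInternal).symm.toLinearMap

theorem toPiece_of_mem {i : ℤ} {m : N.carrier} (hm : m ∈ N.piece i) (j : ℤ) :
    (N.toPiece j m : N.carrier) = if i = j then m else 0 := by
  classical
  have h : (LinearEquiv.ofBijective (DirectSum.coeLinearMap N.piece) N.isInternal).symm m =
      DirectSum.lof K ℤ (fun i => N.piece i) i ⟨m, hm⟩ := by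
    rw [LinearEquiv.symm_apply_eq]
    exact (DirectSum.coeLinearMap_lof N.piece i ⟨m, hm⟩).symm
  rw [toPiece, LinearMap.comp_apply, LinearEquiv.coe_coe, h]
  split_ifs with hij
  · subst hij
    rw [DirectSum.component.lof_self]
  · rw [DirectSum.component.of, dif_neg hij]
    rfl

theorem toPiece_coe (j : ℤ) (m : N.piece j) : N.toPiece j m = m :=
  Subtype.ext (by rw [N.toPiece_of_mem m.2, if_pos rfl])

theorem induction_on {P : N.carrier → Prop} (m : N.carrier) (h0 : P 0)
    (hadd : ∀ a b, P a → P b → P (a + b)) (hmem : ∀ i, ∀ a ∈ N.piece i, P a) : P m := by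
  have hm : m ∈ ⨆ i, N.piece i := by
    rw [N.isInternal.submodule_iSup_eq_top]
    trivial
  exact Submodule.iSup_induction _ (motive := P) hm hmem h0 hadd

theorem toPiece_smul {d : ℕ} {f : MvPolynomial (Fin n) K}
    (hf : f ∈ homogeneousSubmodule (Fin n) K d) (j : ℤ) (m : N.carrier) :
    (N.toPiece j (f • m) : N.carrier) = f • (N.toPiece (j - d) m : N.carrier) := by
  induction m using N.induction_on with
  | h0 => simp
  | hadd a b ha hb => simp [ha, hb]
  | hmem i a ha =>
    rw [N.toPiece_of_mem ha, N.toPiece_of_mem (N.smul_mem d i f a hf ha)]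
    by_cases h : (d : ℤ) + i = j
    · rw [if_pos h, if_pos (by omega)]
    · rw [if_neg h, if_neg (by omega), smul_zero]

theorem finite_setOf_toPiece_ne_zero (m : N.carrier) : {j | N.toPiece j m ≠ 0}.Finite := by
  classical
  set v := (LinearEquiv.ofBijective (DirectSum.coeLinearMap N.piece) N.isInternal).symm m
  exact (DFinsupp.finite_support v)

theorem finite_piece (j : ℤ) : Module.Finite K (N.piece j) := by
  classical
  obtain ⟨G, hG⟩ := N.finite.fg_top
  -- The piece is spanned by monomials of degree `j - i` times degree `i` components of the
  -- generators. For `i > j` the truncation `toNat` only adds harmless extra elements; finiteness of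
  -- `T` is all that matters.
  let T : Set N.carrier := ⋃ g ∈ G, ⋃ i ∈ {i | N.toPiece i g ≠ 0},
    (fun e => monomial e (1 : K) • (N.toPiece i g : N.carrier)) ''
      (Finset.finsuppAntidiag (Finset.univ : Finset (Fin n)) (j - i).toNat : Set (Fin n →₀ ℕ))
  have hT : T.Finite := G.finite_toSet.biUnion fun g _ =>
    (N.finite_setOf_toPiece_ne_zero g).biUnion fun i _ => (Finset.finite_toSet _).image _
  have key : ∀ m : N.carrier, ∀ e : Fin n →₀ ℕ,
      (N.toPiece j (monomial e (1 : K) • m) : N.carrier) ∈ Submodule.span K T := by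
    intro m
    have hm : m ∈ Submodule.span (MvPolynomial (Fin n) K) (G : Set N.carrier) := by
      rw [hG]; trivial
    induction hm using Submodule.span_induction with
    | mem g hg =>
      intro e
      rw [N.toPiece_smul (d := e.degree) (isHomogeneous_monomial _ rfl)]
      by_cases h0 : N.toPiece (j - e.degree) g = 0
      · rw [h0]; simp
      · refine Submodule.subset_span (Set.mem_biUnion hg (Set.mem_biUnion h0 ⟨e, ?_, rfl⟩))
        rw [Finset.mem_coe, Finset.mem_finsuppAntidiag, sub_sub_cancel, Int.toNat_natCast,
          Finsupp.degree_eq_sum]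
        exact ⟨rfl, Finset.subset_univ _⟩
    | zero => intro e; simp
    | add a b _ _ ha hb =>
      intro e
      rw [smul_add, map_add]
      exact Submodule.add_mem _ (ha e) (hb e)
    | smul f a _ ha =>
      intro e
      rw [f.as_sum, Finset.sum_smul, Finset.smul_sum, map_sum, Submodule.coe_sum]
      refine Submodule.sum_mem _ fun e' _ => ?_
      have : monomial e (1 : K) • monomial e' (coeff e' f) • a =
          coeff e' f • monomial (e + e') (1 : K) • a := by
        rw [← mul_smul, monomial_mul, ← smul_assoc, smul_monomial]
        simp
      rw [this, map_smul]
      exact Submodule.smul_mem _ _ (ha _)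
  have hle : N.piece j ≤ Submodule.span K T := fun m hm => by
    have := key m 0
    rwa [← C_apply, C_1, one_smul, N.toPiece_of_mem hm, if_pos rfl] at this
  have := FiniteDimensional.span_of_finite K hT
  exact Submodule.finiteDimensional_of_le hle

section BaseChange

attribute [local instance] MvPolynomial.algebraMvPolynomial

theorem isWeaklyRegular_tensor {A B N : Type*} [CommRing A] [CommRing B] [Algebra A B]
    [AddCommGroup N] [Module A N] [Module.Flat A B] {rs : List A} (h : IsWeaklyRegular N rs) :
    IsWeaklyRegular (B ⊗[A] N) (rs.map (algebraMap A B)) :=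
  h.of_flat_of_isBaseChange (TensorProduct.isBaseChange A N B)

theorem flat_of_isPushout (K A L B : Type*) [Field K] [Field L] [CommRing A] [CommRing B]
    [Algebra K A] [Algebra K L] [Algebra A B] [Algebra L B] [Algebra K B] [IsScalarTower K A B]
    [IsScalarTower K L B] [h : Algebra.IsPushout K A L B] : Module.Flat A B :=
  Module.Flat.isBaseChange K A L B h.out

theorem hasRegSeq_baseChange (L : Type u) [Field L] [Algebra K L]
    {rs : List (MvPolynomial (Fin n) K)} (hrs : ∀ r ∈ rs, r ∈ idealOfVars (Fin n) K)
    (h : IsWeaklyRegular N.carrier rs) :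
    HasRegSeq (Ideal.span (Set.range (X : Fin n → MvPolynomial (Fin n) L))) rs.length
      (MvPolynomial (Fin n) L ⊗[MvPolynomial (Fin n) K] N.carrier) := by
  have hflat : Module.Flat (MvPolynomial (Fin n) K) (MvPolynomial (Fin n) L) :=
    flat_of_isPushout K _ L _
  refine ⟨rs.map (algebraMap (MvPolynomial (Fin n) K) (MvPolynomial (Fin n) L)), by simp, ?_,
    isWeaklyRegular_tensor h⟩
  simp only [List.mem_map, forall_exists_index, and_imp, forall_apply_eq_imp_iff₂]
  intro a ha
  have := Ideal.mem_map_of_mem (algebraMap (MvPolynomial (Fin n) K) (MvPolynomial (Fin n) L))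
    (hrs a ha)
  have hX : algebraMap (MvPolynomial (Fin n) K) (MvPolynomial (Fin n) L) ∘ X = X :=
    funext fun i => by rw [Function.comp_apply, algebraMap_def, map_X]
  rwa [idealOfVars, Ideal.map_span, ← Set.range_comp, hX] at this

/-- If `N` has a weakly regular sequence of length `r` in `(x_1, …, x_n)`, the `r`-th backward
difference of the Hilbert function of `N` is nonnegative. -/
theorem iterate_backwardDiff_hilbertFunction_nonneg {rs : List (MvPolynomial (Fin n) K)}
    (hrs : ∀ r ∈ rs, r ∈ idealOfVars (Fin n) K) (h : IsWeaklyRegular N.carrier rs) (k : ℤ) :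
    0 ≤ backwardDiff^[rs.length] (fun j => (N.hilbertFunction j : ℤ)) k := by
  -- Generic linear forms need an infinite field, while `K` may be finite. Base change to the
  -- polynomial ring over `L` is flat and does not change the Hilbert function.
  let L := AlgebraicClosure K
  have hinf : Infinite L := IsAlgClosed.instInfinite
  have hfin := N.finite
  let e := Algebra.IsPushout.cancelBaseChange K L (MvPolynomial (Fin n) K) (MvPolynomial (Fin n) L)
    N.carrier
  -- `p j` and `s j` are the extended projection and inclusion, so `s j ∘ p j` is the idempotent
  -- that defines the grading after base change.
  let p : ∀ j, MvPolynomial (Fin n) L ⊗[MvPolynomial (Fin n) K] N.carrier →ₗ[L] L ⊗[K] N.piece j :=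
    fun j => (N.toPiece j).baseChange L ∘ₗ e.toLinearMap
  let s : ∀ j, L ⊗[K] N.piece j →ₗ[L] MvPolynomial (Fin n) L ⊗[MvPolynomial (Fin n) K] N.carrier :=
    fun j => e.symm.toLinearMap ∘ₗ (N.piece j).subtype.baseChange L
  have hps : ∀ j z, p j (s j z) = z := by
    intro j z
    simp only [p, s, LinearMap.comp_apply, LinearEquiv.coe_coe, LinearEquiv.apply_symm_apply]
    rw [← LinearMap.comp_apply, ← LinearMap.baseChange_comp]
    have : N.toPiece j ∘ₗ (N.piece j).subtype = LinearMap.id :=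
      LinearMap.ext fun m => N.toPiece_coe j m
    rw [this, LinearMap.baseChange_id, LinearMap.id_apply]
  have hp : ∀ j, Function.Surjective (p j) := fun j z => ⟨_, hps j z⟩
  have hs : ∀ j, Function.Injective (s j) := fun j => Function.LeftInverse.injective (hps j)
  have hrange : ∀ j, LinearMap.range (s j ∘ₗ p j) = LinearMap.range (s j) := fun j =>
    LinearMap.range_comp_of_range_eq_top _ (LinearMap.range_eq_top.mpr (hp j))
  have hfr : ∀ j, Module.finrank L (LinearMap.range (s j ∘ₗ p j)) = N.hilbertFunction j := by
    intro j
    rw [hrange, LinearMap.finrank_range_of_inj (hs j), Module.finrank_baseChange]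
    rfl
  have hcomm : ∀ (i : Fin n) (j : ℤ) z,
      (s j ∘ₗ p j) ((X i : MvPolynomial (Fin n) L) • z) =
        (X i : MvPolynomial (Fin n) L) • (s (j - 1) ∘ₗ p (j - 1)) z := by
    have hX : ∀ (i : Fin n) (l : L) (m : N.carrier),
        (X i : MvPolynomial (Fin n) L) • e.symm (l ⊗ₜ m) =
          e.symm (l ⊗ₜ ((X i : MvPolynomial (Fin n) K) • m)) := by
      intro i l m
      simp only [e, Algebra.IsPushout.cancelBaseChange_symm_tmul]
      rw [TensorProduct.tmul_smul, TensorProduct.smul_tmul', TensorProduct.smul_tmul',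
        Algebra.smul_def (X i : MvPolynomial (Fin n) K), algebraMap_def, map_X, smul_eq_mul]
    intro i j z
    obtain ⟨z, rfl⟩ := e.symm.surjective z
    induction z with
    | zero => simp
    | add a b ha hb => rw [map_add, smul_add, map_add, ha, hb, map_add, smul_add]
    | tmul l m =>
      rw [hX]
      simp only [p, s, LinearMap.comp_apply, LinearEquiv.coe_coe, LinearEquiv.apply_symm_apply,
        LinearMap.baseChange_tmul, Submodule.subtype_apply]
      rw [hX, N.toPiece_smul (d := 1) (isHomogeneous_X K i)]
      simp
  have hpf := N.finite_piece
  have := HasRegSeq.iterate_backwardDiff_nonneg X rs.length (fun j => s j ∘ₗ p j)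
    (fun j z => by simp only [LinearMap.comp_apply, hps]) hcomm
    (fun j => by rw [hrange]; infer_instance) (N.hasRegSeq_baseChange L hrs h) k
  simpa only [hfr] using this

end BaseChange

end FGGradedModule

end HilbertDepth

namespace HilbertDepth

/-! ### Monomial bases of squarefree quotients -/

section SquarefreeQuotient

open MvPolynomial

variable {K : Type u} [Field K] {n : ℕ}

theorem support_monomial_one (e : Fin n →₀ ℕ) : (monomial e (1 : K)).support = {e} := by
  classical
  rw [support_monomial, if_neg one_ne_zero]

theorem sqfreeMonomial_eq_monomial (A : Finset (Fin n)) :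
    sqfreeMonomial K A = monomial (Finsupp.indicator A fun _ _ => 1) 1 := by
  rw [sqfreeMonomial, monomial_eq, C_1, one_mul, Finsupp.prod_of_support_subset _ (s := A)]
  · exact Finset.prod_congr rfl fun i hi => by simp [hi]
  · exact Finsupp.support_indicator_subset _ _
  · simp

theorem indicator_le_iff {A : Finset (Fin n)} {e : Fin n →₀ ℕ} :
    (Finsupp.indicator A fun _ _ => 1) ≤ e ↔ A ⊆ e.support := by
  classical
  simp only [Finsupp.le_def, Finsupp.indicator_apply, Finset.subset_iff, Finsupp.mem_support_iff]
  refine forall_congr' fun i => ?_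
  by_cases hi : i ∈ A <;> simp [hi, Nat.one_le_iff_ne_zero]

theorem mem_span_sqfreeMonomial {F : Set (Finset (Fin n))} {p : MvPolynomial (Fin n) K} :
    p ∈ Ideal.span (sqfreeMonomial K '' F) ↔ ∀ e ∈ p.support, ∃ A ∈ F, A ⊆ e.support := by
  have h : sqfreeMonomial K '' F = (fun e => monomial e (1 : K)) ''
      ((fun A : Finset (Fin n) => Finsupp.indicator A fun _ _ => 1) '' F) := by
    rw [Set.image_image]
    exact Set.image_congr fun A _ => sqfreeMonomial_eq_monomial A
  rw [h, mem_ideal_span_monomial_image]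
  simp [indicator_le_iff]

theorem sqfreeMonomial_mem_span {F : Set (Finset (Fin n))} {B : Finset (Fin n)} :
    sqfreeMonomial K B ∈ Ideal.span (sqfreeMonomial K '' F) ↔ ∃ A ∈ F, A ⊆ B := by
  have hB : (Finsupp.indicator B fun _ _ => 1 : Fin n →₀ ℕ).support = B := by
    ext i; simp [Finsupp.indicator_apply]
  rw [mem_span_sqfreeMonomial, sqfreeMonomial_eq_monomial, support_monomial_one]
  simp [hB]

variable {I : Ideal (MvPolynomial (Fin n) K)}

theorem IsSquarefreeMonomialIdeal.mem_iff (hI : IsSquarefreeMonomialIdeal I)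
    {p : MvPolynomial (Fin n) K} : p ∈ I ↔ ∀ e ∈ p.support, sqfreeMonomial K e.support ∈ I := by
  obtain ⟨F, rfl⟩ := hI
  simp only [mem_span_sqfreeMonomial (p := p), sqfreeMonomial_mem_span]

theorem IsSquarefreeMonomialIdeal.monomial_mem_iff (hI : IsSquarefreeMonomialIdeal I)
    {e : Fin n →₀ ℕ} : monomial e (1 : K) ∈ I ↔ sqfreeMonomial K e.support ∈ I := by
  rw [hI.mem_iff, support_monomial_one]
  simp

open Classical in
/-- The faces of the Stanley–Reisner complex of `I`: the supports of the squarefree monomials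
outside `I`. -/
noncomputable def faces (I : Ideal (MvPolynomial (Fin n) K)) : Finset (Finset (Fin n)) :=
  {A | sqfreeMonomial K A ∉ I}

@[simp]
theorem mem_faces {A : Finset (Fin n)} : A ∈ faces I ↔ sqfreeMonomial K A ∉ I := by
  simp [faces]

theorem alpha_top_eq (j : ℕ) :
    alpha ⊤ I j = ((faces I).filter fun A => A.card = j).card := by
  rw [alpha, ← Set.ncard_coe_finset]
  congr 1
  ext A
  simp [and_comm]

theorem mem_faces_of_subset {A B : Finset (Fin n)} (hAB : A ⊆ B) (hB : B ∈ faces I) :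
    A ∈ faces I := by
  rw [mem_faces] at hB ⊢
  refine fun hA => hB ?_
  rw [sqfreeMonomial, ← Finset.prod_sdiff hAB]
  exact I.mul_mem_left _ hA

-- The monomials of degree `d` whose support is a face form a basis, since membership in `I` is
-- decided monomial by monomial and only through supports.
open Classical in
theorem finrank_quotientPiece (hI : IsSquarefreeMonomialIdeal I) (d : ℕ) :
    Module.finrank K (quotientPiece I d) =
      ((Finset.finsuppAntidiag (Finset.univ : Finset (Fin n)) d).filter
        fun e => e.support ∈ faces I).card := by
  set T := (Finset.finsuppAntidiag (Finset.univ : Finset (Fin n)) d).filter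
    fun e => e.support ∈ faces I with hT
  let v : T → MvPolynomial (Fin n) K ⧸ I := fun e => Ideal.Quotient.mk I (monomial e.1 1)
  have hli : LinearIndependent K v := by
    rw [Fintype.linearIndependent_iff]
    intro g hg e
    have h1 : Ideal.Quotient.mkₐ K I (∑ e : T, g e • monomial e.1 (1 : K)) = 0 := by
      rw [map_sum, ← hg]
      exact Finset.sum_congr rfl fun e _ => map_smul _ _ _
    have h2 := hI.mem_iff.mp (Ideal.Quotient.eq_zero_iff_mem.mp h1) e.1
    by_contra h0
    have hc : coeff e.1 (∑ e : T, g e • monomial e.1 (1 : K)) = g e := by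
      simp only [coeff_sum, coeff_smul, coeff_monomial, smul_eq_mul, mul_ite, mul_one, mul_zero]
      rw [Finset.sum_eq_single e]
      · simp
      · intro b _ hb
        rw [if_neg (fun h => hb (Subtype.ext h))]
      · simp
    have h3 := (Finset.mem_filter.mp e.2).2
    rw [mem_faces] at h3
    exact h3 (h2 (by rw [mem_support_iff, hc]; exact h0))
  have hspan : quotientPiece I d = Submodule.span K (Set.range v) := by
    refine le_antisymm ?_ ?_
    · rintro _ ⟨p, hp, rfl⟩
      rw [p.as_sum, map_sum]
      refine Submodule.sum_mem _ fun e he => ?_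
      have hmon : monomial e (coeff e p) = coeff e p • monomial e (1 : K) := by
        rw [smul_monomial, smul_eq_mul, mul_one]
      rw [hmon, map_smul]
      refine Submodule.smul_mem _ _ ?_
      by_cases hf : e.support ∈ faces I
      · refine Submodule.subset_span ⟨⟨e, ?_⟩, rfl⟩
        rw [hT, Finset.mem_filter, Finset.mem_finsuppAntidiag]
        refine ⟨⟨?_, Finset.subset_univ _⟩, hf⟩
        have := hp (mem_support_iff.mp he)
        rw [← this, ← Finsupp.degree_eq_sum, Finsupp.degree_eq_weight_one]
        rfl
      · rw [mem_faces, not_not, ← hI.monomial_mem_iff] at hf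
        have : (Ideal.Quotient.mkₐ K I).toLinearMap (monomial e 1) = 0 :=
          Ideal.Quotient.eq_zero_iff_mem.mpr hf
        rw [this]
        exact Submodule.zero_mem _
    · rw [Submodule.span_le]
      rintro _ ⟨e, rfl⟩
      refine mk_mem_quotientPiece I (isHomogeneous_monomial _ ?_)
      have := (Finset.mem_finsuppAntidiag.mp (Finset.mem_filter.mp e.2).1).1
      rw [← this, Finsupp.degree_eq_sum]
  rw [hspan, finrank_span_eq_card hli, Fintype.card_coe]

end SquarefreeQuotient

/-! ### Hilbert series and the coefficients `β` -/

section Series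

open PowerSeries

theorem coeff_X_mul_mk_one (m : ℕ) :
    coeff m ((X : ℤ⟦X⟧) * PowerSeries.mk 1) = if m = 0 then 0 else 1 := by
  cases m with
  | zero => simp
  | succ m => rw [coeff_succ_X_mul]; simp

/-- `PowerSeries.mk 1` is `1/(1 - X)`, so `X * PowerSeries.mk 1` counts the positive exponents of
one variable of `A`. -/
theorem coeff_X_mul_mk_one_pow {n : ℕ} (A : Finset (Fin n)) (d : ℕ) :
    coeff d (((X : ℤ⟦X⟧) * PowerSeries.mk 1) ^ A.card) =
      (((Finset.finsuppAntidiag (Finset.univ : Finset (Fin n)) d).filter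
        fun e => e.support = A).card : ℤ) := by
  rw [← Finset.prod_const, coeff_prod, Finset.card_filter, Nat.cast_sum]
  simp only [coeff_X_mul_mk_one]
  rw [← Finset.sum_subset (s₁ := Finset.finsuppAntidiag A d)
    (s₂ := Finset.finsuppAntidiag Finset.univ d)]
  · refine Finset.sum_congr rfl fun e he => ?_
    have hsub := (Finset.mem_finsuppAntidiag.mp he).2
    by_cases h : e.support = A
    · rw [if_pos h, Finset.prod_congr rfl (g := fun _ => (1 : ℤ)), Finset.prod_const_one]
      · simp
      · intro i hi
        rw [← h, Finsupp.mem_support_iff] at hi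
        rw [if_neg hi]
    · obtain ⟨i, hi, hi'⟩ := Finset.exists_of_ssubset (hsub.ssubset_of_ne h)
      rw [if_neg h, Nat.cast_zero]
      exact Finset.prod_eq_zero hi (by simpa using hi')
  · exact Finset.finsuppAntidiag_mono (Finset.subset_univ A) d
  · intro e he he'
    rw [if_neg, Nat.cast_zero]
    rintro rfl
    refine he' (Finset.mem_finsuppAntidiag.mpr ⟨?_, subset_rfl⟩)
    rw [← (Finset.mem_finsuppAntidiag.mp he).1]
    exact Finset.sum_subset (Finset.subset_univ _) fun i _ hi => by simpa using hi

theorem coeff_one_sub_X_pow (m i : ℕ) :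
    coeff i ((1 - X : ℤ⟦X⟧) ^ m) = (-1) ^ i * (m.choose i : ℤ) := by
  induction m generalizing i with
  | zero =>
    cases i <;> simp [coeff_one]
  | succ m ih =>
    rw [pow_succ', sub_mul, one_mul, map_sub, ih]
    cases i with
    | zero => simp
    | succ i => rw [coeff_succ_X_mul, ih, Nat.choose_succ_succ]; push_cast; ring

theorem one_sub_X_pow_mul_X_mul_mk_one_pow {r j : ℕ} (h : j ≤ r) :
    (1 - X : ℤ⟦X⟧) ^ r * (X * PowerSeries.mk 1) ^ j = X ^ j * (1 - X) ^ (r - j) := by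
  have hU : (1 - X : ℤ⟦X⟧) * PowerSeries.mk 1 = 1 := by
    rw [mul_comm]; exact mk_one_mul_one_sub_eq_one ℤ
  obtain ⟨i, rfl⟩ := Nat.exists_eq_add_of_le h
  rw [Nat.add_sub_cancel_left, pow_add, mul_pow]
  calc (1 - X : ℤ⟦X⟧) ^ j * (1 - X) ^ i * (X ^ j * PowerSeries.mk 1 ^ j)
      = ((1 - X) * PowerSeries.mk 1) ^ j * (X ^ j * (1 - X) ^ i) := by rw [mul_pow]; ring
    _ = _ := by rw [hU, one_pow, one_mul]

/-- For `j > r` the product is not a polynomial, but then `j > k` and the factor `X^j` makes the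
coefficient vanish. -/
theorem coeff_one_sub_X_pow_mul {r j k : ℕ} (hk : k ≤ r) :
    coeff k ((1 - X : ℤ⟦X⟧) ^ r * (X * PowerSeries.mk 1) ^ j) =
      if j ≤ k then (-1) ^ (k - j) * ((r - j).choose (k - j) : ℤ) else 0 := by
  split_ifs with h
  · rw [one_sub_X_pow_mul_X_mul_mk_one_pow (h.trans hk), coeff_X_pow_mul', if_pos h,
      coeff_one_sub_X_pow]
  · rw [mul_pow, mul_left_comm, coeff_X_pow_mul', if_neg h]

theorem coeff_iterate_backwardDiff {H : ℤ → ℤ} (hH : ∀ j < 0, H j = 0) (r : ℕ) :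
    (∀ j < 0, backwardDiff^[r] H j = 0) ∧
    PowerSeries.mk (fun k : ℕ => backwardDiff^[r] H k) =
      (1 - X) ^ r * PowerSeries.mk (fun k : ℕ => H k) := by
  induction r with
  | zero => exact ⟨hH, by simp⟩
  | succ r ih =>
    simp only [Function.iterate_succ_apply']
    set G := backwardDiff^[r] H
    refine ⟨fun j hj => by rw [backwardDiff, ih.1 j hj, ih.1 (j - 1) (by omega), sub_zero], ?_⟩
    rw [pow_succ', mul_assoc, ← ih.2, sub_mul, one_mul]
    ext k
    rw [map_sub, coeff_mk, coeff_mk, backwardDiff]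
    cases k with
    | zero => simp [ih.1]
    | succ k => simp [coeff_succ_X_mul]

variable {K : Type u} [Field K] {n : ℕ} {I : Ideal (MvPolynomial (Fin n) K)}

theorem mk_hilbertFunction (hI : IsSquarefreeMonomialIdeal I) :
    PowerSeries.mk (fun d : ℕ => ((sqfreeQuotient I hI).hilbertFunction d : ℤ)) =
      ∑ A ∈ faces I, (X * PowerSeries.mk 1) ^ A.card := by
  classical
  ext d
  rw [coeff_mk, map_sum]
  simp only [coeff_X_mul_mk_one_pow]
  change ((Module.finrank K (quotientPiece I d) : ℕ) : ℤ) = _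
  have hmaps : ∀ e ∈ (Finset.finsuppAntidiag (Finset.univ : Finset (Fin n)) d).filter
      (fun e => e.support ∈ faces I), e.support ∈ faces I := fun e he => (Finset.mem_filter.mp he).2
  rw [finrank_quotientPiece hI, ← Nat.cast_sum, Finset.card_eq_sum_card_fiberwise hmaps]
  congr 1
  refine Finset.sum_congr rfl fun A hA => ?_
  rw [Finset.filter_filter]
  congr 1
  ext e
  simp only [Finset.mem_filter]
  constructor
  · rintro ⟨h1, -, h2⟩; exact ⟨h1, h2⟩
  · rintro ⟨h1, h2⟩; exact ⟨h1, by rwa [h2], h2⟩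

theorem sum_faces (f : ℕ → ℤ) {N : ℕ} (hf : ∀ j, N ≤ j → f j = 0) :
    ∑ A ∈ faces I, f A.card = ∑ j ∈ Finset.range N, (alpha ⊤ I j : ℤ) * f j := by
  classical
  rw [← Finset.sum_filter_add_sum_filter_not (faces I) (fun A => A.card < N)]
  rw [Finset.sum_eq_zero (s := (faces I).filter fun A => ¬ A.card < N), add_zero]
  · rw [← Finset.sum_fiberwise_of_maps_to (g := Finset.card) (t := Finset.range N)]
    · refine Finset.sum_congr rfl fun j hj => ?_
      rw [Finset.sum_congr rfl (g := fun _ => f j)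
        (fun A hA => by rw [(Finset.mem_filter.mp hA).2]), Finset.sum_const, alpha_top_eq,
        Finset.filter_filter, nsmul_eq_mul]
      congr 3
      ext A
      simp only [Finset.mem_filter]
      constructor
      · rintro ⟨h1, -, h2⟩; exact ⟨h1, h2⟩
      · rintro ⟨h1, h2⟩; exact ⟨h1, by rw [h2]; exact Finset.mem_range.mp hj, h2⟩
    · intro A hA
      exact Finset.mem_range.mpr (Finset.mem_filter.mp hA).2
  · intro A hA
    exact hf _ (not_lt.mp (Finset.mem_filter.mp hA).2)

/-- Grouping monomials by support gives `H = ∑ α_j (X/(1-X))^j`, and multiplication by `(1-X)^r`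
turns the `j`-th term, for `j ≤ r`, into `α_j X^j (1-X)^{r-j}`. -/
theorem beta_eq_coeff (hI : IsSquarefreeMonomialIdeal I) {r k : ℕ} (hk : k ≤ r) :
    beta ⊤ I r k = coeff k ((1 - X) ^ r *
      PowerSeries.mk (fun d : ℕ => ((sqfreeQuotient I hI).hilbertFunction d : ℤ))) := by
  rw [mk_hilbertFunction hI, Finset.mul_sum, map_sum, beta]
  simp only [coeff_one_sub_X_pow_mul hk]
  rw [sum_faces (fun j => if j ≤ k then (-1) ^ (k - j) * ((r - j).choose (k - j) : ℤ) else 0)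
    (N := k + 1) (fun j hj => if_neg (by omega))]
  refine Finset.sum_congr rfl fun j hj => ?_
  rw [if_pos (by simpa [Nat.lt_succ_iff] using hj)]
  ring

/-- The coefficients `β_k^r(S/I)` are nonnegative if `r` is at most the depth of a module with the
same Hilbert function as `S/I`. -/
theorem beta_nonneg_of_le_depth (hI : IsSquarefreeMonomialIdeal I) {N : FGGradedModule K n}
    (hN : N.hilbertFunction = (sqfreeQuotient I hI).hilbertFunction) {r k : ℕ}
    (hr : (r : ℕ∞) ≤ N.depth) (hk : k ≤ r) : 0 ≤ beta ⊤ I r k := by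
  obtain ⟨rs, hrs, hreg, hlen⟩ : ∃ rs : List (MvPolynomial (Fin n) K),
      (∀ a ∈ rs, a ∈ MvPolynomial.idealOfVars (Fin n) K) ∧
      RingTheory.Sequence.IsWeaklyRegular N.carrier rs ∧ rs.length = r := by
    by_cases hr0 : r = 0
    · subst hr0
      exact ⟨[], by simp, by simp, rfl⟩
    -- The depth is a supremum in `ℕ∞` and need not be known to be attained; a regular sequence
    -- longer than `r - 1` is found and cut to its first `r` members.
    · have hlt : ((r - 1 : ℕ) : ℕ∞) < N.depth := lt_of_lt_of_le (by
        exact_mod_cast Nat.sub_lt (Nat.pos_of_ne_zero hr0) one_pos) hr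
      simp only [FGGradedModule.depth, lt_iSup_iff] at hlt
      obtain ⟨rs, hrs, hreg, hlt⟩ := hlt
      have hlen : r ≤ rs.length := by
        have : r - 1 < rs.length := by exact_mod_cast hlt
        omega
      refine ⟨rs.take r, fun a ha => hrs a (List.mem_of_mem_take ha), ?_, by simpa using hlen⟩
      have := hreg.toIsWeaklyRegular
      rw [← List.take_append_drop r rs,
        RingTheory.Sequence.isWeaklyRegular_append_iff] at this
      exact this.1
  have hneg : ∀ j < 0, (N.hilbertFunction j : ℤ) = 0 := by
    intro j hj
    rw [hN]
    obtain ⟨m, rfl⟩ := Int.exists_eq_neg_ofNat hj.le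
    cases m with
    | zero => simp at hj
    | succ m =>
      change ((Module.finrank K (⊥ : Submodule K (MvPolynomial (Fin n) K ⧸ I)) : ℕ) : ℤ) = 0
      simp
  have h := N.iterate_backwardDiff_hilbertFunction_nonneg hrs hreg k
  have h2 := congrArg (coeff k) (coeff_iterate_backwardDiff hneg rs.length).2
  rw [coeff_mk] at h2
  rw [beta_eq_coeff hI hk, ← hN, ← hlen, ← h2]
  exact h

theorem beta_nonneg_of_le_hdepth (hI : IsSquarefreeMonomialIdeal I) {r k : ℕ}
    (hr : (r : ℕ∞) ≤ (sqfreeQuotient I hI).hdepth) (hk : k ≤ r) : 0 ≤ beta ⊤ I r k := by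
  by_cases hr0 : r = 0
  · subst hr0
    exact beta_nonneg_of_le_depth hI (N := sqfreeQuotient I hI) rfl (by simp) hk
  · have hlt : ((r - 1 : ℕ) : ℕ∞) < (sqfreeQuotient I hI).hdepth := lt_of_lt_of_le (by
      exact_mod_cast Nat.sub_lt (Nat.pos_of_ne_zero hr0) one_pos) hr
    simp only [FGGradedModule.hdepth, lt_iSup_iff] at hlt
    obtain ⟨N, hN, hlt⟩ := hlt
    refine beta_nonneg_of_le_depth hI hN ?_ hk
    have := Order.add_one_le_of_lt hlt
    have h1 : r - 1 + 1 = r := Nat.sub_add_cancel (Nat.pos_of_ne_zero hr0)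
    rw [← h1]
    exact_mod_cast this

end Series

end HilbertDepth

/-! ### Modules of prescribed depth and Hilbert series -/

namespace HilbertDepth

open RingTheory.Sequence Pointwise

theorem isWeaklyRegular_pi {R : Type*} [CommRing R] {ι : Type*} [Finite ι] {M : ι → Type*}
    [∀ i, AddCommGroup (M i)] [∀ i, Module R (M i)] {rs : List R}
    (h : ∀ i, IsWeaklyRegular (M i) rs) : IsWeaklyRegular (∀ i, M i) rs := by
  classical
  have := Fintype.ofFinite ι
  induction rs generalizing M with
  | nil => simp
  | cons a rs ih =>
    simp only [isWeaklyRegular_cons_iff] at h ⊢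
    refine ⟨fun x y hxy => funext fun i => (h i).1 (congrFun hxy i), ?_⟩
    have hsub : a • (⊤ : Submodule R (∀ i, M i)) =
        Submodule.pi Set.univ fun i => a • (⊤ : Submodule R (M i)) := by
      ext m
      simp only [mem_smul_top_iff, Submodule.mem_pi, Set.mem_univ, forall_const]
      constructor
      · rintro ⟨m, rfl⟩ i
        exact ⟨m i, rfl⟩
      · intro hm
        choose m' hm' using hm
        exact ⟨m', funext hm'⟩
    exact (((Submodule.quotEquivOfEq _ _ hsub).trans
      (Submodule.quotientPi _)).isWeaklyRegular_congr rs).mpr (ih fun i => (h i).2)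

namespace FGGradedModule

variable {K : Type u} [Field K] {n : ℕ}

/-- The direct sum of finitely many graded modules, the `i`-th one shifted by `s i`. -/
noncomputable def shiftedPi {ι : Type} [Finite ι] (N : ι → FGGradedModule K n) (s : ι → ℤ) :
    FGGradedModule K n where
  carrier := ∀ i, (N i).carrier
  finite := by
    have := fun i => (N i).finite
    infer_instance
  piece j := Submodule.pi Set.univ fun i => (N i).piece (j - s i)
  isInternal := by
    classical
    have := Fintype.ofFinite ι
    rw [DirectSum.isInternal_submodule_iff_iSupIndep_and_iSup_eq_top]
    constructor
    · let π : ∀ j : ℤ, (∀ i, (N i).carrier) →ₗ[K] ∀ i, (N i).piece (j - s i) := fun j =>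
        LinearMap.pi fun i => (N i).toPiece (j - s i) ∘ₗ LinearMap.proj i
      rw [iSupIndep_def]
      intro j
      rw [Submodule.disjoint_def]
      intro x hx hx'
      have hle : (⨆ i, ⨆ (_ : i ≠ j), Submodule.pi Set.univ fun i' => (N i').piece (i - s i')) ≤
          LinearMap.ker (π j) := by
        refine iSup_le fun k => iSup_le fun hk y hy => ?_
        refine funext fun i => Subtype.ext ?_
        change ((N i).toPiece (j - s i) (y i) : (N i).carrier) = 0
        rw [(N i).toPiece_of_mem (hy i trivial), if_neg (by omega)]
      funext i
      have h1 := congrArg Subtype.val (congrFun (hle hx') i)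
      change ((N i).toPiece (j - s i) (x i) : (N i).carrier) = 0 at h1
      rwa [(N i).toPiece_of_mem (hx i trivial), if_pos rfl] at h1
    · rw [eq_top_iff]
      rintro x -
      rw [← Finset.univ_sum_single x]
      refine Submodule.sum_mem _ fun i _ => ?_
      generalize x i = m
      induction m using (N i).induction_on with
      | h0 => simp
      | hadd a b ha hb => rw [Pi.single_add]; exact Submodule.add_mem _ ha hb
      | hmem k a ha =>
        refine Submodule.mem_iSup_of_mem (k + s i) fun i' _ => ?_
        by_cases h : i' = i
        · subst h
          simpa using ha
        · rw [Pi.single_eq_of_ne h]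
          exact Submodule.zero_mem _
  smul_mem i j f m hf hm := fun i' _ => by
    have := (N i').smul_mem i _ f (m i') hf (hm i' trivial)
    rwa [← add_sub_assoc] at this

theorem hilbertFunction_shiftedPi {ι : Type} [Fintype ι] (N : ι → FGGradedModule K n) (s : ι → ℤ)
    (j : ℤ) : (shiftedPi N s).hilbertFunction j = ∑ i, (N i).hilbertFunction (j - s i) := by
  have := fun i => (N i).finite_piece
  let e : (shiftedPi N s).piece j ≃ₗ[K] ∀ i, (N i).piece (j - s i) :=
    { toFun := fun x i => ⟨x.1 i, x.2 i trivial⟩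
      invFun := fun x => ⟨fun i => x i, fun i _ => (x i).2⟩
      map_add' := fun _ _ => rfl
      map_smul' := fun _ _ => rfl
      left_inv := fun _ => rfl
      right_inv := fun _ => rfl }
  exact e.finrank_eq.trans (Module.finrank_pi_fintype K)

end FGGradedModule

section Variables

open MvPolynomial

variable {K : Type u} [Field K] {n : ℕ}

theorem X_image_eq (T : Set (Fin n)) : (X '' T : Set (MvPolynomial (Fin n) K)) =
    sqfreeMonomial K '' ((fun i => {i}) '' T) := by
  rw [Set.image_image]
  exact Set.image_congr fun i _ => by simp [sqfreeMonomial]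

theorem isSquarefreeMonomialIdeal_span_X (T : Set (Fin n)) :
    IsSquarefreeMonomialIdeal (Ideal.span (X '' T : Set (MvPolynomial (Fin n) K))) :=
  ⟨_, by rw [X_image_eq]⟩

theorem isSMulRegular_X {T : Set (Fin n)} {i : Fin n} (hi : i ∉ T) :
    IsSMulRegular (MvPolynomial (Fin n) K ⧸ Ideal.span (X '' T : Set (MvPolynomial (Fin n) K)))
      (X i : MvPolynomial (Fin n) K) := by
  refine IsSMulRegular.of_right_eq_zero_of_smul fun m hm => ?_
  obtain ⟨p, rfl⟩ := Ideal.Quotient.mk_surjective m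
  have h1 : X i * p ∈ Ideal.span (X '' T : Set (MvPolynomial (Fin n) K)) :=
    Ideal.Quotient.eq_zero_iff_mem.mp hm
  refine Ideal.Quotient.eq_zero_iff_mem.mpr ?_
  rw [mem_ideal_span_X_image] at h1 ⊢
  intro e he
  obtain ⟨j, hj, hne⟩ := h1 (Finsupp.single i 1 + e) (by
    rw [mem_support_iff, coeff_X_mul]
    exact mem_support_iff.mp he)
  have hij : i ≠ j := fun h => hi (h ▸ hj)
  exact ⟨j, hj, by simpa [Finsupp.single_apply, hij] using hne⟩

/-- Dividing `S/(T)` by a variable outside `T` gives the quotient by one more variable, so the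
induction runs over `T`. -/
theorem isWeaklyRegular_map_X (l : List (Fin n)) (hl : l.Nodup) (T : Set (Fin n))
    (hT : ∀ i ∈ l, i ∉ T) :
    IsWeaklyRegular (MvPolynomial (Fin n) K ⧸ Ideal.span (X '' T : Set (MvPolynomial (Fin n) K)))
      (l.map (X : Fin n → MvPolynomial (Fin n) K)) := by
  induction l generalizing T with
  | nil => simp
  | cons i l ih =>
    rw [List.nodup_cons] at hl
    rw [List.map_cons, isWeaklyRegular_cons_iff]
    refine ⟨isSMulRegular_X (hT i (by simp)), ?_⟩
    set J := Ideal.span (X '' T : Set (MvPolynomial (Fin n) K)) with hJ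
    set J' := Ideal.span (X '' (insert i T) : Set (MvPolynomial (Fin n) K)) with hJ'
    have hle : J ≤ J' := Ideal.span_mono (Set.image_mono (Set.subset_insert i T))
    have hmap : (X i : MvPolynomial (Fin n) K) • (⊤ : Submodule (MvPolynomial (Fin n) K)
        (MvPolynomial (Fin n) K ⧸ J)) = Submodule.map (Submodule.mkQ J) J' := by
      ext m
      obtain ⟨p, rfl⟩ := Submodule.Quotient.mk_surjective _ m
      rw [mem_smul_top_iff, Submodule.mem_map]
      constructor
      · rintro ⟨m', hm'⟩
        obtain ⟨p', rfl⟩ := Submodule.Quotient.mk_surjective _ m'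
        exact ⟨X i * p', J'.mul_mem_right _ (Ideal.subset_span ⟨i, by simp, rfl⟩), hm'⟩
      · rintro ⟨y, hy, hyp⟩
        rw [hJ', Set.image_insert_eq, Ideal.mem_span_insert] at hy
        obtain ⟨a, z, hz, rfl⟩ := hy
        refine ⟨Submodule.Quotient.mk a, ?_⟩
        rw [← hyp, ← Submodule.Quotient.mk_smul, Submodule.mkQ_apply, eq_comm,
          Submodule.Quotient.eq, smul_eq_mul, mul_comm a]
        simpa using hz
    let e := (Submodule.quotEquivOfEq _ _ hmap).trans
      (Submodule.quotientQuotientEquivQuotient J J' hle)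
    refine (e.isWeaklyRegular_congr _).mpr (ih hl.2 _ fun j hj => ?_)
    rw [Set.mem_insert_iff, not_or]
    exact ⟨fun h => hl.1 (h ▸ hj), hT j (by simp [hj])⟩

theorem faces_span_X (T : Finset (Fin n)) :
    faces (Ideal.span (X '' (T : Set (Fin n)) : Set (MvPolynomial (Fin n) K))) = Tᶜ.powerset := by
  ext A
  rw [mem_faces, X_image_eq, sqfreeMonomial_mem_span, Finset.mem_powerset,
    Finset.subset_compl_iff_disjoint_left, Finset.disjoint_left]
  simp

theorem mk_hilbertFunction_span_X (T : Finset (Fin n)) :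
    PowerSeries.mk (fun d : ℕ => ((sqfreeQuotient _ (isSquarefreeMonomialIdeal_span_X (K := K)
      (T : Set (Fin n)))).hilbertFunction d : ℤ)) = PowerSeries.mk 1 ^ Tᶜ.card := by
  rw [mk_hilbertFunction, faces_span_X]
  have h := Finset.sum_pow_mul_eq_add_pow ((PowerSeries.X : PowerSeries ℤ) * PowerSeries.mk 1) 1 Tᶜ
  simp only [one_pow, mul_one] at h
  rw [h]
  congr 1
  have hU : (PowerSeries.mk 1 : PowerSeries ℤ) * (1 - PowerSeries.X) = 1 :=
    PowerSeries.mk_one_mul_one_sub_eq_one ℤ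
  linear_combination -hU

theorem one_notMem_idealOfVars : (1 : MvPolynomial (Fin n) K) ∉ idealOfVars (Fin n) K := by
  intro h
  have := (C_mem_pow_idealOfVars_iff (σ := Fin n) (R := K) 1 1).mp (by simpa using h)
  simp at this

/-- A nonzero direct sum of shifted quotients by variables outside `x_0, …, x_{r-1}` has depth at
least `r`. -/
theorem le_depth_shiftedPi {ι : Type} [Finite ι] [Nonempty ι] (T : ι → Set (Fin n)) (s : ι → ℤ)
    {r : ℕ} (hr : r ≤ n) (hT : ∀ i, ∀ j ∈ T i, r ≤ (j : ℕ)) :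
    (r : ℕ∞) ≤ (FGGradedModule.shiftedPi (fun i => sqfreeQuotient (K := K) _
      (isSquarefreeMonomialIdeal_span_X (T i))) s).depth := by
  let l : List (Fin n) := List.ofFn fun i : Fin r => Fin.castLE hr i
  have hl : l.Nodup := List.nodup_ofFn.mpr (Fin.castLE_injective hr)
  have hlT : ∀ i, ∀ j ∈ l, j ∉ T i := by
    intro i j hj hjT
    obtain ⟨k, rfl⟩ := (List.mem_ofFn' _ _).mp hj
    have := hT i _ hjT
    simp only [Fin.val_castLE] at this
    omega
  let rs := l.map (X : Fin n → MvPolynomial (Fin n) K)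
  have hmem : ∀ a ∈ rs, a ∈ idealOfVars (Fin n) K := by
    intro a ha
    obtain ⟨j, -, rfl⟩ := List.mem_map.mp ha
    exact Ideal.subset_span ⟨j, rfl⟩
  have hweak : IsWeaklyRegular
      (∀ i, MvPolynomial (Fin n) K ⧸ Ideal.span (X '' T i : Set (MvPolynomial (Fin n) K))) rs :=
    isWeaklyRegular_pi fun i => isWeaklyRegular_map_X l hl (T i) (hlT i)
  have hreg : IsRegular
      (∀ i, MvPolynomial (Fin n) K ⧸ Ideal.span (X '' T i : Set (MvPolynomial (Fin n) K))) rs := by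
    -- Properness: one factor surjects onto `S/𝔪 ≠ 0`, and this quotient is annihilated by the
    -- sequence.
    refine ⟨hweak, fun htop => ?_⟩
    obtain ⟨i⟩ := ‹Nonempty ι›
    have hle : Ideal.span (X '' T i : Set (MvPolynomial (Fin n) K)) ≤ idealOfVars (Fin n) K :=
      Ideal.span_mono (Set.image_subset_range _ _)
    let φ : (∀ i, MvPolynomial (Fin n) K ⧸ Ideal.span (X '' T i : Set (MvPolynomial (Fin n) K)))
        →ₗ[MvPolynomial (Fin n) K] MvPolynomial (Fin n) K ⧸ idealOfVars (Fin n) K :=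
      Submodule.factor hle ∘ₗ LinearMap.proj i
    have hker : (Ideal.ofList rs • ⊤ : Submodule (MvPolynomial (Fin n) K) _) ≤ φ.ker := by
      refine Submodule.smul_le.mpr fun a ha m _ => ?_
      rw [LinearMap.mem_ker, map_smul]
      have ha' : a ∈ idealOfVars (Fin n) K := by
        refine (Ideal.span_le.mpr ?_ : Ideal.ofList rs ≤ _) ha
        exact fun b hb => hmem b hb
      obtain ⟨p, hp⟩ := Ideal.Quotient.mk_surjective (φ m)
      rw [← hp]
      exact Ideal.Quotient.eq_zero_iff_mem.mpr (Ideal.mul_mem_right _ _ ha')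
    rw [← htop] at hker
    have h1 : φ (fun _ => Ideal.Quotient.mk _ 1) = 0 := hker trivial
    exact one_notMem_idealOfVars (Ideal.Quotient.eq_zero_iff_mem.mp h1)
  have hlen : rs.length = r := by simp [rs, l]
  rw [FGGradedModule.depth, ← hlen]
  exact le_iSup_of_le rs (le_iSup_of_le hmem (le_iSup_of_le hreg le_rfl))

end Variables

/-! ### Lower bound for the Hilbert depth -/

section LowerBound

open PowerSeries

variable {K : Type u} [Field K] {n : ℕ} {I : Ideal (MvPolynomial (Fin n) K)}

theorem hilbertFunction_of_neg (hI : IsSquarefreeMonomialIdeal I) {j : ℤ} (hj : j < 0) :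
    (sqfreeQuotient I hI).hilbertFunction j = 0 := by
  obtain ⟨m, rfl⟩ := Int.exists_eq_neg_ofNat hj.le
  cases m with
  | zero => simp at hj
  | succ m =>
    change Module.finrank K (⊥ : Submodule K (MvPolynomial (Fin n) K ⧸ I)) = 0
    simp

theorem sum_beta_mul_X_pow (r : ℕ) :
    (∑ k ∈ Finset.range (r + 1), C (beta ⊤ I r k) * X ^ k : ℤ⟦X⟧) =
      ∑ j ∈ Finset.range (r + 1), C (alpha ⊤ I j : ℤ) * (X ^ j * (1 - X) ^ (r - j)) := by
  ext k
  simp only [map_sum, coeff_C_mul, coeff_X_pow, coeff_X_pow_mul', coeff_one_sub_X_pow]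
  by_cases hk : k ≤ r
  · rw [Finset.sum_eq_single k (fun b _ hb => by rw [if_neg hb.symm, mul_zero])
      (fun h => absurd (Finset.mem_range.mpr (by omega)) h), if_pos rfl, mul_one, beta]
    rw [← Finset.sum_subset (Finset.range_mono (by omega : k + 1 ≤ r + 1))]
    · refine Finset.sum_congr rfl fun j hj => ?_
      rw [if_pos (by simpa [Nat.lt_succ_iff] using hj)]
      ring
    · intro j _ hj
      rw [if_neg (by simpa [Nat.lt_succ_iff] using hj), mul_zero]
  · rw [Finset.sum_eq_zero, Finset.sum_eq_zero]
    · intro j hj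
      have : j ≤ r := by simpa [Nat.lt_succ_iff] using hj
      rw [if_pos (by omega), Nat.choose_eq_zero_of_lt (by omega)]
      simp
    · intro j hj
      have : j ≤ r := by simpa [Nat.lt_succ_iff] using hj
      rw [if_neg (by omega), mul_zero]

theorem sum_beta_mul_X_pow_mul (r : ℕ) :
    (∑ k ∈ Finset.range (r + 1), C (beta ⊤ I r k) * (X ^ k * PowerSeries.mk 1 ^ r) : ℤ⟦X⟧) =
      ∑ j ∈ Finset.range (r + 1), C (alpha ⊤ I j : ℤ) * (X * PowerSeries.mk 1) ^ j := by
  have hU : (1 - X : ℤ⟦X⟧) * PowerSeries.mk 1 = 1 := by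
    rw [mul_comm]; exact mk_one_mul_one_sub_eq_one ℤ
  have h := congrArg (· * (PowerSeries.mk 1 : ℤ⟦X⟧) ^ r) (sum_beta_mul_X_pow (I := I) r)
  simp only [Finset.sum_mul, mul_assoc] at h
  rw [h]
  refine Finset.sum_congr rfl fun j hj => ?_
  have hj' : j ≤ r := by simpa [Nat.lt_succ_iff] using hj
  obtain ⟨i, rfl⟩ := Nat.exists_eq_add_of_le hj'
  rw [Nat.add_sub_cancel_left, pow_add, mul_pow, mul_left_comm ((1 - X) ^ i), ← mul_pow, hU,
    one_pow, mul_one]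

theorem sum_faces_series (f : ℕ → ℤ⟦X⟧) :
    ∑ A ∈ faces I, f A.card = ∑ j ∈ Finset.range (n + 1), C (alpha ⊤ I j : ℤ) * f j := by
  ext k
  have hf := sum_faces (I := I) (fun j => if j ≤ n then coeff k (f j) else 0) (N := n + 1)
    (fun j hj => if_neg (by omega))
  rw [map_sum, map_sum]
  simp only [coeff_C_mul]
  rw [Finset.sum_congr rfl (fun A _ => (if_pos (by simpa using A.card_le_univ)).symm), hf]
  refine Finset.sum_congr rfl fun j hj => ?_
  rw [if_pos (by simpa [Nat.lt_succ_iff] using hj)]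

theorem alpha_zero (hI : I ≠ ⊤) : alpha ⊤ I 0 = 1 := by
  rw [alpha_top_eq, Finset.card_eq_one]
  refine ⟨∅, ?_⟩
  ext A
  simp only [Finset.mem_filter, mem_faces, Finset.card_eq_zero, Finset.mem_singleton]
  constructor
  · exact fun h => h.2
  · rintro rfl
    refine ⟨fun h => hI ((Ideal.eq_top_iff_one I).mpr ?_), rfl⟩
    simpa [sqfreeMonomial] using h

/-- Nonnegativity of the coefficients `β_k^r(S/I)`, `k ≤ r`, yields a module of depth at least `r`
with the same Hilbert function as `S/I`. -/
theorem le_hdepth_of_beta_nonneg (hI : IsSquarefreeMonomialIdeal I) (htop : I ≠ ⊤) {r : ℕ}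
    (hr : r ≤ n) (hβ : ∀ k ≤ r, 0 ≤ beta ⊤ I r k) :
    (r : ℕ∞) ≤ (sqfreeQuotient I hI).hdepth := by
  -- These multiplicities are read off from `H = ∑_{k ≤ r} β_k X^k/(1-X)^r + ∑_{k > r} α_k
  -- X^k/(1-X)^k`. The `k`-th term consists of polynomial rings in the first `max k r` variables,
  -- generated in degree `k`, so the first `r` variables are regular on every summand.
  let mult : ℕ → ℕ := fun k => if k ≤ r then (beta ⊤ I r k).toNat else alpha ⊤ I k
  let ι := Σ k : Fin (n + 1), Fin (mult k)
  let T : ι → Finset (Fin n) := fun i => {j | max (i.1 : ℕ) r ≤ j}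
  have hTcard : ∀ i, (T i)ᶜ.card = max (i.1 : ℕ) r := by
    intro i
    have : (T i)ᶜ = Finset.univ.filter fun j : Fin n => (j : ℕ) < max (i.1 : ℕ) r := by
      ext j; simp only [T, Finset.mem_compl, Finset.mem_filter, Finset.mem_univ, true_and, not_le]
    rw [this, Fin.card_filter_val_lt]
    exact min_eq_right (max_le (Nat.lt_succ_iff.mp i.1.2) hr)
  have hne : Nonempty ι := by
    refine ⟨⟨0, ⟨0, ?_⟩⟩⟩
    have : beta ⊤ I r 0 = 1 := by simp [beta, alpha_zero htop]
    simp [mult, this]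
  let N := FGGradedModule.shiftedPi (fun i : ι => sqfreeQuotient (K := K) _
    (isSquarefreeMonomialIdeal_span_X (T i : Set (Fin n)))) (fun i => ((i.1 : ℕ) : ℤ))
  have hdepth : (r : ℕ∞) ≤ N.depth := le_depth_shiftedPi (fun i => (T i : Set (Fin n))) _ hr
    fun i j hj => by
      simp only [T, Finset.coe_filter, Finset.mem_univ, true_and, Set.mem_ofPred_eq] at hj
      exact (le_max_right _ _).trans hj
  have hseries : PowerSeries.mk (fun d : ℕ => (N.hilbertFunction d : ℤ)) =
      PowerSeries.mk (fun d : ℕ => ((sqfreeQuotient I hI).hilbertFunction d : ℤ)) := by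
    have h1 : PowerSeries.mk (fun d : ℕ => (N.hilbertFunction d : ℤ)) =
        ∑ i : ι, (X ^ (i.1 : ℕ) * PowerSeries.mk 1 ^ max (i.1 : ℕ) r : ℤ⟦X⟧) := by
      ext d
      rw [coeff_mk, FGGradedModule.hilbertFunction_shiftedPi, map_sum, Nat.cast_sum]
      refine Finset.sum_congr rfl fun i _ => ?_
      rw [← hTcard, ← mk_hilbertFunction_span_X (K := K), coeff_X_pow_mul']
      split_ifs with h
      · rw [coeff_mk, Nat.cast_sub h]
      · rw [hilbertFunction_of_neg _ (by omega), Nat.cast_zero]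
    rw [h1, mk_hilbertFunction hI, sum_faces_series (fun j => (X * PowerSeries.mk 1) ^ j),
      Fintype.sum_sigma]
    simp only [Finset.sum_const, Finset.card_univ, Fintype.card_fin]
    rw [Fin.sum_univ_eq_sum_range
      (fun k => mult k • (X ^ k * PowerSeries.mk 1 ^ max k r : ℤ⟦X⟧)) (n + 1),
      ← Finset.sum_range_add_sum_Ico _ (by omega : r + 1 ≤ n + 1),
      ← Finset.sum_range_add_sum_Ico _ (by omega : r + 1 ≤ n + 1), ← sum_beta_mul_X_pow_mul]
    congr 1
    · refine Finset.sum_congr rfl fun k hk => ?_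
      have hk' : k ≤ r := by simpa [Nat.lt_succ_iff] using hk
      rw [max_eq_right hk', nsmul_eq_mul]
      congr 1
      have : (mult k : ℤ) = beta ⊤ I r k := by simp [mult, hk', hβ k hk']
      rw [← this]
      simp
    · refine Finset.sum_congr rfl fun k hk => ?_
      have hk' : r < k := (Finset.mem_Ico.mp hk).1
      have : mult k = alpha ⊤ I k := if_neg (by omega)
      rw [max_eq_left hk'.le, nsmul_eq_mul, mul_pow, this]
      congr 1
  have hN : N.hilbertFunction = (sqfreeQuotient I hI).hilbertFunction := by
    funext j
    rcases lt_or_ge j 0 with hj | hj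
    · rw [hilbertFunction_of_neg hI hj, FGGradedModule.hilbertFunction_shiftedPi]
      exact Finset.sum_eq_zero fun i _ => hilbertFunction_of_neg _ (by omega)
    · lift j to ℕ using hj
      have := congrArg (coeff j) hseries
      simpa using this
  exact hdepth.trans (le_iSup_of_le N (le_iSup_of_le hN le_rfl))

end LowerBound

end HilbertDepth

namespace HilbertDepth

/-! ### A simplex with an isolated point -/

section CliqueWithPoint

/-- The ideal of the simplicial complex that is the disjoint union of a full simplex on `x`
vertices and a point. -/
noncomputable def cliquePointIdeal (K : Type u) [Field K] (x : ℕ) :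
    Ideal (MvPolynomial (Fin (x + 1)) K) :=
  Ideal.span (sqfreeMonomial K '' Set.range fun i : Fin x => {i.castSucc, Fin.last x})

variable {K : Type u} [Field K] {x : ℕ}

theorem isSquarefreeMonomialIdeal_cliquePointIdeal :
    IsSquarefreeMonomialIdeal (cliquePointIdeal K x) := ⟨_, rfl⟩

theorem cliquePointIdeal_le : cliquePointIdeal K x ≤ MvPolynomial.idealOfVars (Fin (x + 1)) K ^ 2 := by
  rw [cliquePointIdeal, Ideal.span_le]
  rintro _ ⟨_, ⟨i, rfl⟩, rfl⟩
  rw [sqfreeMonomial, Finset.prod_pair (Fin.castSucc_lt_last i).ne, pow_two]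
  exact Ideal.mul_mem_mul (Ideal.subset_span ⟨_, rfl⟩) (Ideal.subset_span ⟨_, rfl⟩)

theorem ne_top_of_le_sq {n : ℕ} {I : Ideal (MvPolynomial (Fin n) K)}
    (h : I ≤ MvPolynomial.idealOfVars (Fin n) K ^ 2) : I ≠ ⊤ := by
  rintro rfl
  exact one_notMem_idealOfVars (Ideal.pow_le_self two_ne_zero (h trivial))

theorem faces_cliquePointIdeal : faces (cliquePointIdeal K x) =
    insert {Fin.last x} (({Fin.last x} : Finset (Fin (x + 1)))ᶜ.powerset) := by
  ext A
  rw [mem_faces, cliquePointIdeal, sqfreeMonomial_mem_span, Finset.mem_insert,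
    Finset.mem_powerset, Finset.subset_compl_iff_disjoint_left, Finset.disjoint_singleton_left]
  simp only [Set.exists_range_iff, Finset.insert_subset_iff, Finset.singleton_subset_iff,
    not_exists, not_and]
  constructor
  · intro h
    by_cases hl : Fin.last x ∈ A
    · left
      ext i
      rw [Finset.mem_singleton]
      constructor
      · intro hi
        induction i using Fin.lastCases with
        | last => rfl
        | cast i => exact absurd hl (h i hi)
      · rintro rfl
        exact hl
    · exact .inr hl
  · rintro (rfl | h) i hi
    · exact absurd (Finset.mem_singleton.mp hi) (Fin.castSucc_lt_last i).ne
    · exact h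

-- The Hilbert series is `1/(1-X)^x + X/(1-X)`. With `x = (r+1) + (z+1)`, multiplication by
-- `(1-X)^{r+1}` leaves `1/(1-X)^{z+1} + X(1-X)^r`.
open PowerSeries in
theorem beta_cliquePointIdeal {r z k : ℕ} (hx : x = r + 1 + z + 1) (hk : k + 1 ≤ r + 1) :
    beta ⊤ (cliquePointIdeal K x) (r + 1) (k + 1) =
      ((z + (k + 1)).choose (k + 1) : ℤ) + (-1) ^ k * (r.choose k : ℤ) := by
  have hU : (PowerSeries.mk 1 : ℤ⟦X⟧) * (1 - X) = 1 := mk_one_mul_one_sub_eq_one ℤ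
  have hser : (1 - X : ℤ⟦X⟧) ^ (r + 1) * PowerSeries.mk (fun d : ℕ =>
      ((sqfreeQuotient _ (isSquarefreeMonomialIdeal_cliquePointIdeal (K := K)
        (x := x))).hilbertFunction d : ℤ)) = PowerSeries.mk 1 ^ (z + 1) + X * (1 - X) ^ r := by
    rw [mk_hilbertFunction, faces_cliquePointIdeal, Finset.sum_insert (by simp)]
    have h := Finset.sum_pow_mul_eq_add_pow ((X : ℤ⟦X⟧) * PowerSeries.mk 1) 1
      ({Fin.last x} : Finset (Fin (x + 1)))ᶜ
    simp only [one_pow, mul_one] at h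
    have hU' : (X : ℤ⟦X⟧) * PowerSeries.mk 1 + 1 = PowerSeries.mk 1 := by linear_combination -hU
    have hc : ({Fin.last x} : Finset (Fin (x + 1)))ᶜ.card = (r + 1) + (z + 1) := by
      rw [Finset.card_compl, Finset.card_singleton, Fintype.card_fin]; omega
    have hU'' : (1 - X : ℤ⟦X⟧) ^ (r + 1) * PowerSeries.mk 1 ^ (r + 1) = 1 := by
      rw [← mul_pow, mul_comm, hU, one_pow]
    rw [h, hU', hc, Finset.card_singleton, pow_one]
    linear_combination (PowerSeries.mk 1 : ℤ⟦X⟧) ^ (z + 1) * hU'' + X * (1 - X) ^ r * hU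
  rw [beta_eq_coeff isSquarefreeMonomialIdeal_cliquePointIdeal hk, hser, map_add,
    mk_one_pow_eq_mk_choose_add, coeff_mk, coeff_succ_X_mul, coeff_one_sub_X_pow,
    Nat.choose_symm_add]

end CliqueWithPoint

/-! ### The counterexamples for `q ≥ 8` -/

section Counterexample

/-- Positivity of the even coefficients `β_k^q` of the union of a simplex on `q + z + 1` vertices
and a point. -/
def EvenBound (q z : ℕ) : Prop :=
  ∀ k, Odd k → k + 1 ≤ q → (q - 1).choose k ≤ (z + (k + 1)).choose (k + 1)

/-- The case `k = 3` reads `binom(q-1, 3) ≤ binom(q-1, 4)`, which is where `q ≥ 8` is needed. For `k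
≥ 5` the right side has upper index at least `q`, and Pascal's rule suffices. -/
theorem evenBound_sub_five {q : ℕ} (hq : 8 ≤ q) : EvenBound q (q - 5) := by
  intro k hodd hk
  obtain ⟨m, rfl⟩ := Nat.exists_eq_add_of_le hq
  obtain ⟨i, rfl⟩ := hodd
  have h5 : 8 + m - 5 = m + 3 := by omega
  have h1 : 8 + m - 1 = m + 7 := by omega
  rw [h5, h1]
  match i with
  | 0 =>
    have : (m + 3 + 2).choose 2 = (m + 5) * (m + 4) / 2 := by rw [Nat.choose_two_right]; rfl
    change (m + 7).choose 1 ≤ (m + 3 + 2).choose 2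
    rw [Nat.choose_one_right, this, Nat.le_div_iff_mul_le two_pos]
    nlinarith
  | 1 =>
    have h := Nat.choose_succ_right_eq (m + 7) 3
    change (m + 7).choose 3 ≤ (m + 7).choose 4
    have : (m + 7).choose 4 * 4 = (m + 7).choose 3 * (m + 4) := h
    nlinarith
  | i + 2 =>
    calc (m + 7).choose (2 * (i + 2) + 1)
        ≤ (m + 7 + 1).choose (2 * (i + 2) + 1 + 1) := by
          rw [Nat.choose_succ_succ]; exact Nat.le_add_right _ _
      _ ≤ _ := Nat.choose_le_choose _ (by omega)

theorem not_evenBound_zero {q : ℕ} (hq : 8 ≤ q) : ¬ EvenBound q 0 := by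
  intro h
  have := h 1 odd_one (by omega)
  simp at this
  omega

theorem exists_hdepth_eq_and_lt_beta (K : Type u) [Field K] {q : ℕ} (hq : 8 ≤ q) :
    ∃ (n : ℕ) (I : Ideal (MvPolynomial (Fin n) K)) (hI : IsSquarefreeMonomialIdeal I),
      q ≤ n ∧ I ≤ MvPolynomial.idealOfVars (Fin n) K ^ 2 ∧
      (sqfreeQuotient I hI).hdepth = (q : ℕ∞) ∧ ((n - q + 2).choose 3 : ℤ) < beta ⊤ I q 3 := by
  classical
  have hex : ∃ z, EvenBound q z := ⟨_, evenBound_sub_five hq⟩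
  obtain ⟨z, hz, hzle, hzmin⟩ : ∃ z, EvenBound q z ∧ z ≤ q - 5 ∧ ∀ m < z, ¬ EvenBound q m :=
    ⟨Nat.find hex, Nat.find_spec hex, Nat.find_min' hex (evenBound_sub_five hq),
      fun _ => Nat.find_min hex⟩
  obtain ⟨w, rfl⟩ : ∃ w, z = w + 1 := Nat.exists_eq_succ_of_ne_zero
    fun h => not_evenBound_zero hq (h ▸ hz)
  obtain ⟨p, rfl⟩ : ∃ p, q = p + 1 := ⟨q - 1, by omega⟩
  set x := p + 1 + (w + 1) + 1 with hx
  have hI := isSquarefreeMonomialIdeal_cliquePointIdeal (K := K) (x := x)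
  refine ⟨x + 1, cliquePointIdeal K x, hI, by omega, cliquePointIdeal_le, le_antisymm ?_ ?_, ?_⟩
  -- The same complex also has `x = (q + 1) + w + 1`, now with `w = z - 1`. Since `w` violates the
  -- bound for some odd `k`, the coefficient `β_{k+1}^{q+1}` is negative.
  · by_contra hlt
    have hle := Order.add_one_le_of_lt (not_le.mp hlt)
    have hlt' := hzmin w (Nat.lt_succ_self w)
    simp only [EvenBound, not_forall, not_le] at hlt'
    obtain ⟨k, hodd, hk, hlt'⟩ := hlt'
    have h := beta_nonneg_of_le_hdepth hI (r := p + 1 + 1) (k := k + 1) (by exact_mod_cast hle)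
      (by omega)
    rw [beta_cliquePointIdeal (z := w) (by omega) (by omega), hodd.neg_one_pow] at h
    have h1 : p.choose k ≤ (p + 1).choose k := Nat.choose_le_choose _ (Nat.le_succ p)
    rw [Nat.add_sub_cancel] at hlt'
    omega
  · refine le_hdepth_of_beta_nonneg hI (ne_top_of_le_sq cliquePointIdeal_le) (by omega) ?_
    intro k hk
    cases k with
    | zero => simp [beta]
    | succ k =>
      rw [beta_cliquePointIdeal hx hk]
      rcases Nat.even_or_odd k with he | ho
      · rw [he.neg_one_pow]; positivity
      · rw [ho.neg_one_pow]
        have := hz k ho hk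
        rw [Nat.add_sub_cancel] at this
        omega
  · rw [beta_cliquePointIdeal hx (by omega)]
    -- Here `n - q + 2 = z + 4` and `β_3^q = binom(z+3, 3) + binom(q-1, 2)`. By Pascal's rule the
    -- claim is `binom(z+3, 2) < binom(q-1, 2)`, which follows from `z ≤ q - 5`.
    have h1 : x + 1 - (p + 1) + 2 = w + 1 + 3 + 1 := by omega
    have h2 : (w + 1 + 3).choose 2 < p.choose 2 := by
      have h3 : (w + 1 + 3 + 1).choose 2 ≤ p.choose 2 := Nat.choose_le_choose _ (by omega)
      have h4 : (w + 1 + 3 + 1).choose 2 = (w + 1 + 3).choose 1 + (w + 1 + 3).choose 2 :=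
        Nat.choose_succ_succ' _ _
      rw [Nat.choose_one_right] at h4
      omega
    rw [h1, Nat.choose_succ_succ' (w + 1 + 3) 2]
    push_cast
    have : ((w + 1 + 3).choose 2 : ℤ) < p.choose 2 := by exact_mod_cast h2
    norm_num
    linarith

end Counterexample

end HilbertDepth

namespace HilbertDepth

open Finset

open scoped FinsetFamily

/-! ### Colexicographic segments and cascade representations -/

section KruskalKatona

variable {n : ℕ}

/-- There is an initial segment of the colexicographic order on `r`-subsets of
`{0, …, a - 1} ⊆ Fin n` with `c` elements and at least `s` elements in its shadow. -/
def HasInitSeg (n a r c s : ℕ) : Prop :=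
  ∃ 𝒞 : Finset (Finset (Fin n)), Colex.IsInitSeg 𝒞 r ∧ (∀ A ∈ 𝒞, ∀ x ∈ A, (x : ℕ) < a) ∧
    #𝒞 = c ∧ s ≤ #(∂ 𝒞)

theorem HasInitSeg.one {a : ℕ} (h0 : 0 < a) (ha : a ≤ n) : HasInitSeg n a 1 a 1 := by
  refine ⟨(univ.filter fun x : Fin n => (x : ℕ) < a).image fun x => {x}, ⟨?_, ?_⟩, ?_, ?_, ?_⟩
  · intro A hA
    obtain ⟨x, -, rfl⟩ := mem_image.mp (mem_coe.mp hA)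
    exact card_singleton x
  · intro s t hs ht
    obtain ⟨x, hx, rfl⟩ := mem_image.mp hs
    obtain ⟨y, rfl⟩ := card_eq_one.mp ht.2
    have := Colex.singleton_lt_singleton.mp ht.1
    refine mem_image.mpr ⟨y, mem_filter.mpr ⟨mem_univ _, ?_⟩, rfl⟩
    exact lt_trans this (mem_filter.mp hx).2
  · intro A hA x hx
    obtain ⟨y, hy, rfl⟩ := mem_image.mp hA
    rw [mem_singleton.mp hx]
    exact (mem_filter.mp hy).2
  · rw [card_image_of_injective _ singleton_injective, Fin.card_filter_val_lt, min_eq_right ha]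
  · refine card_pos.mpr ⟨∅, mem_shadow_iff_insert_mem.mpr ⟨⟨0, by omega⟩, by simp, ?_⟩⟩
    exact mem_image.mpr ⟨⟨0, by omega⟩, by simpa using h0, by simp⟩

/-- One step of the cascade representation: in colex order the `(r+1)`-subsets of `{0, …, a-1}` come
first, followed by the sets `{a} ∪ B` with `B` in the order of the `r`-subsets. The shadow contains
the analogous union one size lower. -/
theorem HasInitSeg.step {a' a r c s : ℕ} (h : HasInitSeg n a' r c s) (haa : a' ≤ a) (ha : a < n)
    (hc : 0 < c) : HasInitSeg n (a + 1) (r + 1) (a.choose (r + 1) + c) (a.choose r + s) := by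
  obtain ⟨𝒞, hseg, hlt, hcard, hsh⟩ := h
  let b : Fin n := ⟨a, ha⟩
  let S : Finset (Fin n) := univ.filter fun x => x < b
  have hS : #S = a := by
    have : S = univ.filter fun x : Fin n => (x : ℕ) < a := rfl
    rw [this, Fin.card_filter_val_lt, min_eq_right ha.le]
  have hmemS : ∀ x, x ∈ S ↔ x < b := fun x => by simp [S]
  have hbC : ∀ A ∈ 𝒞, A ⊆ S := fun A hA x hx =>
    (hmemS x).mpr (Fin.lt_def.mpr ((hlt A hA x hx).trans_le haa))
  have hbS : b ∉ S := by simp [S]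
  have hinj : ∀ ℬ : Finset (Finset (Fin n)), (∀ A ∈ ℬ, A ⊆ S) → #(ℬ.image (insert b)) = #ℬ := by
    intro ℬ hℬ
    refine card_image_of_injOn fun A hA B hB hAB => ?_
    rw [← erase_insert (fun h => hbS (hℬ A hA h)), ← erase_insert (fun h => hbS (hℬ B hB h))]
    exact congrArg (fun D => erase D b) hAB
  have hdisj : ∀ (ℬ : Finset (Finset (Fin n))) k,
      Disjoint (powersetCard k S) (ℬ.image (insert b)) := by
    intro ℬ k
    rw [disjoint_left]
    intro A hA hA'
    obtain ⟨B, -, rfl⟩ := mem_image.mp hA'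
    exact hbS ((mem_powersetCard.mp hA).1 (mem_insert_self _ _))
  refine ⟨powersetCard (r + 1) S ∪ 𝒞.image (insert b), ⟨?_, ?_⟩, ?_, ?_, ?_⟩
  · intro A hA
    rcases mem_union.mp (mem_coe.mp hA) with hA | hA
    · exact (mem_powersetCard.mp hA).2
    · obtain ⟨B, hB, rfl⟩ := mem_image.mp hA
      rw [card_insert_of_notMem fun h => hbS (hbC B hB h), hseg.1 hB]
  · intro A t hA ht
    have hle : ∀ x ∈ t, x ≤ b := by
      refine Colex.forall_le_mono ht.1.le fun x hx => ?_
      rcases mem_union.mp hA with hA | hA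
      · exact ((hmemS x).mp ((mem_powersetCard.mp hA).1 hx)).le
      · obtain ⟨B, hB, rfl⟩ := mem_image.mp hA
        rcases mem_insert.mp hx with rfl | hx
        · exact le_rfl
        · exact ((hmemS x).mp (hbC B hB hx)).le
    by_cases hbt : b ∈ t
    · refine mem_union_right _ (mem_image.mpr ⟨t.erase b, ?_, insert_erase hbt⟩)
      rcases mem_union.mp hA with hA | hA
      · have := Colex.forall_lt_mono ht.1.le
          (fun x hx => (hmemS x).mp ((mem_powersetCard.mp hA).1 hx)) b hbt
        exact absurd this (lt_irrefl _)
      · obtain ⟨B, hB, rfl⟩ := mem_image.mp hA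
        have hbB : b ∉ B := fun h => hbS (hbC B hB h)
        -- Deleting the common element `b` from both sets preserves the colex order.
        refine hseg.2 hB ⟨?_, by rw [card_erase_of_mem hbt, ht.2]; rfl⟩
        have := ht.1
        rw [← insert_erase hbt] at this
        have h2 := (Colex.toColex_sdiff_lt_toColex_sdiff (u := {b}) (by simp) (by simp)).mpr this
        simpa [insert_sdiff_of_mem, sdiff_singleton_eq_erase, hbB] using h2
    · refine mem_union_left _ (mem_powersetCard.mpr ⟨fun x hx => (hmemS x).mpr ?_, ht.2⟩)
      exact lt_of_le_of_ne (hle x hx) fun h => hbt (h ▸ hx)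
  · intro A hA x hx
    rcases mem_union.mp hA with hA | hA
    · exact Nat.lt_succ_of_lt (Fin.lt_def.mp ((hmemS x).mp ((mem_powersetCard.mp hA).1 hx)))
    · obtain ⟨B, hB, rfl⟩ := mem_image.mp hA
      rcases mem_insert.mp hx with rfl | hx
      · exact Nat.lt_succ_self a
      · exact Nat.lt_succ_of_lt ((hlt B hB x hx).trans_le haa)
  · rw [card_union_of_disjoint (hdisj _ _), card_powersetCard, hS, hinj _ hbC, hcard]
  · have hshC : ∀ A ∈ ∂ 𝒞, A ⊆ S := fun A hA =>
      let ⟨B, hB, hAB⟩ := exists_subset_of_mem_shadow hA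
      hAB.trans (hbC B hB)
    calc a.choose r + s ≤ #(powersetCard r S ∪ (∂ 𝒞).image (insert b)) := by
          rw [card_union_of_disjoint (hdisj _ _), card_powersetCard, hS, hinj _ hshC]
          exact Nat.add_le_add_left hsh _
      _ ≤ _ := card_le_card ?_
    intro t ht
    rw [mem_shadow_iff_insert_mem]
    rcases mem_union.mp ht with ht | ht
    · obtain ⟨htS, htr⟩ := mem_powersetCard.mp ht
      -- An `r`-subset of `S` extends inside `S` unless it is `S` itself. In that case `r = a`, and
      -- the nonempty family `𝒞` must contain `S`, so `S ∪ {b}` covers it; this is the use of `hc`.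
      by_cases hex : ∃ x ∈ S, x ∉ t
      · obtain ⟨x, hxS, hxt⟩ := hex
        refine ⟨x, hxt, mem_union_left _ (mem_powersetCard.mpr ⟨insert_subset hxS htS, ?_⟩)⟩
        rw [card_insert_of_notMem hxt, htr]
      · push Not at hex
        obtain rfl : t = S := htS.antisymm hex
        obtain ⟨B, hB⟩ := card_pos.mp (hcard ▸ hc)
        have hBS : B = S := eq_of_subset_of_card_le (hbC B hB) (by rw [hseg.1 hB, htr])
        exact ⟨b, hbS, mem_union_right _ (mem_image_of_mem _ (hBS ▸ hB))⟩
    · obtain ⟨B, hB, rfl⟩ := mem_image.mp ht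
      obtain ⟨x, hxB, hx⟩ := mem_shadow_iff_insert_mem.mp hB
      have hxb : x ≠ b := fun h => hbS (h ▸ hbC _ hx (mem_insert_self _ _))
      refine ⟨x, by simp [hxb, hxB], mem_union_right _ (mem_image.mpr ⟨_, hx, ?_⟩)⟩
      exact insert_comm _ _ _

theorem HasInitSeg.le_card_shadow {a r c s : ℕ} (h : HasInitSeg n a r c s)
    {𝒜 : Finset (Finset (Fin n))} (h𝒜 : (𝒜 : Set (Finset (Fin n))).Sized r) (hc : c ≤ #𝒜) :
    s ≤ #(∂ 𝒜) := by
  obtain ⟨𝒞, hseg, -, rfl, hs⟩ := h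
  exact hs.trans (kruskal_katona h𝒜 hc hseg)

end KruskalKatona

end HilbertDepth

namespace HilbertDepth

/-! ### Face numbers and the bound for `q = 5, 6, 7` -/

section FVector

open Finset

open scoped FinsetFamily

variable {K : Type u} [Field K] {n : ℕ} {I : Ideal (MvPolynomial (Fin n) K)}

theorem sized_filter_faces (j : ℕ) :
    (((faces I).filter fun A => #A = j : Finset (Finset (Fin n))) : Set (Finset (Fin n))).Sized j :=
  fun _ hA => (mem_filter.mp (mem_coe.mp hA)).2

theorem card_shadow_faces_le (j : ℕ) :
    #(∂ ((faces I).filter fun A => #A = j + 1)) ≤ alpha ⊤ I j := by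
  rw [alpha_top_eq]
  refine card_le_card fun A hA => ?_
  obtain ⟨B, hB, hAB, hcard⟩ := mem_shadow_iff_exists_mem_card_add_one.mp hA
  rw [mem_filter] at hB ⊢
  exact ⟨mem_faces_of_subset hAB hB.1, by omega⟩

theorem le_alpha_of_hasInitSeg {a j c s : ℕ} (h : HasInitSeg n a (j + 1) c s)
    (hc : c ≤ alpha ⊤ I (j + 1)) : s ≤ alpha ⊤ I j :=
  (h.le_card_shadow (sized_filter_faces _) (by rwa [alpha_top_eq] at hc)).trans
    (card_shadow_faces_le j)

theorem alpha_le_choose (j : ℕ) : alpha ⊤ I j ≤ n.choose j := by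
  rw [alpha_top_eq]
  calc _ ≤ #(powersetCard j (univ : Finset (Fin n))) := card_le_card fun A hA =>
        mem_powersetCard.mpr ⟨subset_univ _, (mem_filter.mp hA).2⟩
    _ = n.choose j := by simp

theorem alpha_one (hI : I ≤ MvPolynomial.idealOfVars (Fin n) K ^ 2) : alpha ⊤ I 1 = n := by
  refine (alpha_le_choose 1).antisymm ?_ |>.trans (Nat.choose_one_right n)
  rw [Nat.choose_one_right, alpha_top_eq]
  calc n = #((univ : Finset (Fin n)).image fun i => ({i} : Finset (Fin n))) := by
        rw [card_image_of_injective _ singleton_injective, card_univ, Fintype.card_fin]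
    _ ≤ _ := card_le_card fun A hA => ?_
  obtain ⟨i, -, rfl⟩ := mem_image.mp hA
  refine mem_filter.mpr ⟨mem_faces.mpr fun h => ?_, card_singleton i⟩
  have h2 := hI h
  rw [sqfreeMonomial, prod_singleton, MvPolynomial.X,
    MvPolynomial.monomial_mem_pow_idealOfVars_iff _ _ one_ne_zero] at h2
  simp at h2

theorem alpha_three_mul_le : alpha ⊤ I 3 * 3 ≤ alpha ⊤ I 2 * (n - 3 + 1) := by
  have h := local_lubell_yamamoto_meshalkin_inequality_mul (sized_filter_faces (I := I) 3)
  rw [Fintype.card_fin] at h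
  calc alpha ⊤ I 3 * 3 ≤ _ := by rw [alpha_top_eq]; exact h
    _ ≤ _ := Nat.mul_le_mul_right _ (card_shadow_faces_le 2)

/-- The Kruskal–Katona bound for the number of triangles in terms of the number of edges. -/
theorem alpha_three_le {a b : ℕ} (ha : 2 ≤ a) (han : a < n) (hba : b ≤ a)
    (h : alpha ⊤ I 2 ≤ a.choose 2 + b) : alpha ⊤ I 3 ≤ a.choose 3 + b.choose 2 := by
  -- One triangle too many gives the cascade `binom(a,3) + binom(b,2) + binom(1,1)` for `0 < b < a`,
  -- whose shadow has at least `binom(a,2) + b + 1` edges. For `b = 0` the extra triangle is counted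
  -- by `binom(2,2)`; for `b = a` the pair `(a, a)` acts as `(a + 1, 0)`.
  have hbase : HasInitSeg n 1 1 1 1 := .one one_pos (by omega)
  have htwo : HasInitSeg n 2 2 1 2 := hbase.step le_rfl (by omega) one_pos
  by_contra! hlt
  rcases Nat.eq_zero_or_pos b with rfl | hb
  · have hseg : HasInitSeg n (a + 1) 3 (a.choose 3 + 1) (a.choose 2 + 2) := htwo.step ha han one_pos
    have := le_alpha_of_hasInitSeg hseg (I := I) (by simpa using hlt)
    omega
  rcases hba.eq_or_lt with rfl | hba
  · have h3 : (b + 1).choose 3 = b.choose 2 + b.choose 3 := Nat.choose_succ_succ' _ _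
    have h2 : (b + 1).choose 2 = b.choose 1 + b.choose 2 := Nat.choose_succ_succ' _ _
    rw [Nat.choose_one_right] at h2
    have h4 := alpha_le_choose (I := I) 3
    rcases Nat.eq_or_lt_of_le (Nat.succ_le_of_lt han) with hn | hn
    · have h5 : n.choose 3 = (b + 1).choose 3 := by rw [← hn]
      omega
    · have hseg : HasInitSeg n (b + 1 + 1) 3 ((b + 1).choose 3 + 1) ((b + 1).choose 2 + 2) :=
        htwo.step (by omega) hn one_pos
      have := le_alpha_of_hasInitSeg hseg (I := I) (show _ ≤ alpha ⊤ I 3 by omega)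
      omega
  · have hseg : HasInitSeg n (a + 1) 3 (a.choose 3 + (b.choose 2 + 1))
        (a.choose 2 + (b.choose 1 + 1)) :=
      (hbase.step (a := b) hb (by omega) one_pos).step hba han (by omega)
    have := le_alpha_of_hasInitSeg hseg (I := I) (show _ ≤ alpha ⊤ I 3 by omega)
    rw [Nat.choose_one_right] at this
    omega

theorem exists_eq_choose_two_add {n m : ℕ} (hn : 3 ≤ n) (hm : 1 ≤ m) (hmn : m ≤ n.choose 2) :
    ∃ a b, 2 ≤ a ∧ a < n ∧ b ≤ a ∧ m = a.choose 2 + b := by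
  induction n, hn using Nat.le_induction with
  | base =>
    have : Nat.choose 3 2 = 3 := rfl
    have : Nat.choose 2 2 = 1 := rfl
    exact ⟨2, m - 1, le_rfl, by omega, by omega, by omega⟩
  | succ n hn ih =>
    rcases le_or_gt m (n.choose 2) with h | h
    · obtain ⟨a, b, h1, h2, h3, h4⟩ := ih h
      exact ⟨a, b, h1, by omega, h3, h4⟩
    · have h2 : (n + 1).choose 2 = n.choose 1 + n.choose 2 := Nat.choose_succ_succ' _ _
      rw [Nat.choose_one_right] at h2
      exact ⟨n, m - n.choose 2, by omega, by omega, by omega, by omega⟩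

/-- The conclusion is the desired bound on `β_3^q` with `α_3` replaced by its Kruskal–Katona
maximum. The third condition is `β_2^q ≥ 0`, and `n + 4 < 3q ≤ 21` forces `n < 17`. -/
theorem triangle_bound_check : ∀ q ∈ Icc 5 7, ∀ n ∈ range 17, ∀ a ∈ range n, ∀ b ∈ range (a + 1),
    n + 4 < 3 * q ∧ q ≤ n ∧ (q - 1) * n ≤ q.choose 2 + (a.choose 2 + b) ∧
      ¬ (q = 7 ∧ n = 11 ∧ a.choose 2 + b = 45) →
    a.choose 3 + b.choose 2 + (q - 1).choose 2 * n ≤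
      (n - q + 2).choose 3 + q.choose 3 + (q - 2) * (a.choose 2 + b) := by
  decide +kernel

/-- Bootstrapping between `α_3` and `α_4`: if `α_3 ≥ 116`, then `h4` gives `α_4 ≥ 199`, whose shadow
forces `α_3 ≥ 118`; this gives `α_4 ≥ 207` and `α_3 ≥ 119`, then `α_4 ≥ 211` and `α_3 ≥ 123`,
against `α_3 ≤ 120`. -/
theorem alpha_three_le_of_seven_eleven (hn : n = 11) (h2 : alpha ⊤ I 2 = 45)
    (h4 : 4 * alpha ⊤ I 3 ≤ alpha ⊤ I 4 + 265) : alpha ⊤ I 3 ≤ 115 := by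
  subst hn
  have hle : alpha ⊤ I 3 ≤ 120 :=
    alpha_three_le (a := 10) (b := 0) (by omega) (by omega) (by omega) (by rw [h2]; decide)
  -- The cascades are `197 = binom(9,4) + binom(8,3) + binom(5,2) + binom(5,1)`, `203 = binom(9,4) +
  -- binom(8,3) + binom(6,2) + binom(6,1)` and `211 = binom(10,4) + 1`.
  have s1 : HasInitSeg 11 10 4 197 118 :=
    (((HasInitSeg.one (n := 11) (a := 5) (by omega) (by omega)).step (a := 5) le_rfl
      (by omega) (by omega)).step (a := 8) (by omega) (by omega) (by decide)).step (a := 9)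
      le_rfl (by omega) (by decide)
  have s2 : HasInitSeg 11 10 4 203 119 :=
    (((HasInitSeg.one (n := 11) (a := 6) (by omega) (by omega)).step (a := 6) le_rfl
      (by omega) (by omega)).step (a := 8) (by omega) (by omega) (by decide)).step (a := 9)
      le_rfl (by omega) (by decide)
  have s3 : HasInitSeg 11 11 4 211 123 :=
    (((HasInitSeg.one (n := 11) (a := 1) (by omega) (by omega)).step (a := 1) le_rfl
      (by omega) (by omega)).step (a := 2) (by omega) (by omega) (by decide)).step (a := 10)
      (by omega) (by omega) (by decide)
  by_contra! hlt
  have h118 := le_alpha_of_hasInitSeg s1 (I := I) (show _ ≤ alpha ⊤ I 4 by omega)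
  have h119 := le_alpha_of_hasInitSeg s2 (I := I) (show _ ≤ alpha ⊤ I 4 by omega)
  have h123 := le_alpha_of_hasInitSeg s3 (I := I) (show _ ≤ alpha ⊤ I 4 by omega)
  omega

theorem six_mul_choose_three (m : ℕ) : 6 * ((m + 2).choose 3 : ℤ) = (m + 2) * (m + 1) * m := by
  induction m with
  | zero => simp
  | succ m ih =>
    have h3 : (m + 1 + 2).choose 3 = (m + 2).choose 2 + (m + 2).choose 3 :=
      Nat.choose_succ_succ' _ _
    have h2' : (m + 2).choose 2 * 2 = (m + 2) * (m + 1) := by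
      rw [Nat.choose_two_right]
      exact Nat.div_mul_cancel (Nat.even_mul_pred_self (m + 2)).two_dvd
    zify at h3 h2'
    rw [h3]
    push_cast
    linear_combination ih + 3 * h2'

theorem beta_three_le (hI : I ≤ MvPolynomial.idealOfVars (Fin n) K ^ 2) {q : ℕ}
    (hq : q = 5 ∨ q = 6 ∨ q = 7) (hβ : ∀ k ≤ q, 0 ≤ beta ⊤ I q k) :
    beta ⊤ I q 3 ≤ ((n - q + 2).choose 3 : ℤ) := by
  have h0 := alpha_zero (ne_top_of_le_sq hI)
  have h1 := alpha_one hI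
  have hb1 := hβ 1 (by omega)
  have hb2 := hβ 2 (by omega)
  have hqn : q ≤ n := by
    simp only [beta, Finset.sum_range_succ, Finset.sum_range_zero, h0, h1] at hb1
    simp at hb1
    omega
  have hedge : (q - 1) * n ≤ q.choose 2 + alpha ⊤ I 2 := by
    simp only [beta, Finset.sum_range_succ, Finset.sum_range_zero, h0, h1] at hb2
    zify [show 1 ≤ q by omega]
    simp at hb2
    rw [Nat.cast_sub (by omega)] at hb2
    push_cast at hb2
    linarith
  have hb3 : beta ⊤ I q 3 = alpha ⊤ I 3 - (q - 2) * alpha ⊤ I 2 + (q - 1).choose 2 * n -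
      q.choose 3 := by
    simp only [beta, Finset.sum_range_succ, Finset.sum_range_zero, h0, h1]
    simp
    rw [Nat.cast_sub (by omega)]
    push_cast
    ring
  by_cases hn : n + 4 < 3 * q
  · obtain ⟨a, b, ha, han, hba, hab⟩ := exists_eq_choose_two_add (n := n) (m := alpha ⊤ I 2)
      (by omega) (by rcases hq with rfl | rfl | rfl <;> simp [Nat.choose] at hedge <;> omega)
      (alpha_le_choose 2)
    have h3 := alpha_three_le ha han hba hab.le
    by_cases hexc : q = 7 ∧ n = 11 ∧ a.choose 2 + b = 45
    · obtain ⟨rfl, hn11, h45⟩ := hexc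
      -- Kruskal–Katona alone allows `α_3 = 120`, hence `β_3 = 25 > 20`. The inequality `β_4^7 ≥ 0`
      -- becomes `4 α_3 ≤ α_4 + 265` and lowers the bound to `115`, which gives exactly `20`.
      have hb4 := hβ 4 (by omega)
      simp only [beta, Finset.sum_range_succ, Finset.sum_range_zero, h0, h1] at hb4
      simp [Nat.choose] at hb4
      have := alpha_three_le_of_seven_eleven hn11 (hab.trans h45) (by omega)
      have hc : (n - 7 + 2).choose 3 = 20 := by rw [hn11]; rfl
      rw [hb3, hc]
      simp [Nat.choose]
      omega
    · have hcheck := triangle_bound_check q (mem_Icc.mpr (by omega)) n (mem_range.mpr (by omega)) a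
        (mem_range.mpr han) b (mem_range.mpr (by omega)) ⟨hn, hqn, by rwa [← hab], hexc⟩
      rw [← hab] at hcheck
      rw [hb3]
      zify [show 2 ≤ q by omega] at hcheck h3
      linarith
  · obtain ⟨m, rfl⟩ := Nat.exists_eq_add_of_le hqn
    have hlym := alpha_three_mul_le (I := I)
    have h2 := alpha_le_choose (I := I) 2
    have hc3 := six_mul_choose_three m
    have hc2 : (q + m).choose 2 * 2 = (q + m) * (q + m - 1) := by
      rw [Nat.choose_two_right]
      exact Nat.div_mul_cancel (Nat.even_mul_pred_self (q + m)).two_dvd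
    rw [show q + m - 3 + 1 = q + m - 2 by omega] at hlym
    zify [show 1 ≤ q + m by omega, show 2 ≤ q + m by omega] at hlym hc2 h2 hn
    rw [hb3, Nat.add_sub_cancel_left]
    -- After `3 α_3 ≤ (n - 2) α_2` the coefficient of `α_2` in the bound for `β_3^q` is `(n + 4 -
    -- 3q)/3 ≥ 0`, so `α_2` may be raised to `binom(n, 2)`, where the bound equals `binom(n-q+2,
    -- 3)`.
    have hprod : 0 ≤ ((q : ℤ) + m + 4 - 3 * q) * ((q + m).choose 2 - alpha ⊤ I 2) :=
      mul_nonneg (by linarith) (by linarith)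
    rcases hq with rfl | rfl | rfl <;> simp [Nat.choose] at hprod hlym hc2 hc3 ⊢ <;> nlinarith

end FVector

end HilbertDepth

theorem lemma4p1 (K : Type u) [Field K] :
    (∀ (n q : ℕ) (I : Ideal (MvPolynomial (Fin n) K))
        (hI : HilbertDepth.IsSquarefreeMonomialIdeal I),
      I ≤ MvPolynomial.idealOfVars (Fin n) K ^ 2 →
      (HilbertDepth.sqfreeQuotient I hI).hdepth = (q : ℕ∞) →
      (q = 5 ∨ q = 6 ∨ q = 7) →
      HilbertDepth.beta ⊤ I q 3 ≤ ((n - q + 2).choose 3 : ℤ)) ∧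
    (∀ q : ℕ, 8 ≤ q →
      ∃ (n : ℕ) (I : Ideal (MvPolynomial (Fin n) K))
        (hI : HilbertDepth.IsSquarefreeMonomialIdeal I),
        q ≤ n ∧ I ≤ MvPolynomial.idealOfVars (Fin n) K ^ 2 ∧
        (HilbertDepth.sqfreeQuotient I hI).hdepth = (q : ℕ∞) ∧
        ((n - q + 2).choose 3 : ℤ) < HilbertDepth.beta ⊤ I q 3) :=
  ⟨fun _ _ _ hI hle hdepth hq => HilbertDepth.beta_three_le hle hq fun _ hk =>
      HilbertDepth.beta_nonneg_of_le_hdepth hI hdepth.ge hk,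
    fun _ hq => HilbertDepth.exists_hdepth_eq_and_lt_beta K hq⟩
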